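/- Let $I=(-1,1)$, $k\in\{1,2\}$, $b,f\in H^k(I)$ with $0<\underline b\le b(x)\le\overline b$ in $I$. For $\varepsilon\in(0,1]$ let $u_\varepsilon\in H^1_0(I)$ be the weak solution of $-\varepsilon^2u''+bu=f$ in $I$, $u(\pm1)=0$, i.e. $\int_I(\varepsilon^2u_\varepsilon'v'+b\,u_\varepsilon v)\,dx=\int_I fv\,dx$ for all $v\in H^1_0(I)$. A neural network $\Phi=((A_1,b_1),\dots,(A_L,b_L))$ with matrices $A_\ell\in\mathbb R^{N_\ell\times N_{\ell-1}}$ and vectors $b_\ell\in\mathbb R^{N_\ell}$ has depth $L$, width $\max_{1\le\ell\le L}N_\ell$, size $M(\Phi)$ equal to the number of nonzero entries of all $A_\ell,b_\ell$, and ReLU realization $\mathrm R(\Phi):x_0\mapsto x_L$, where $x_\ell=\max\{0,A_\ell x_{\ell-1}+b_\ell\}$ (componentwise) for $\ell<L$ and $x_L=A_Lx_{L-1}+b_L$. Put $\theta=4/\sqrt{\underline b}$. For $N$ divisible by $4$ and a function $\phi$ with $\phi(0)=0$, let $\lambda=\theta\varepsilon\phi(1/2)$ and consider the nodes $$x_i=\begin{cases}-1+\theta\varepsilon\,\phi(2i/N),&0\le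 i\le N/4,\\ \frac{4i}{N}(1-\lambda)-2+2\lambda,&N/4\le i\le 3N/4,\\ 1-\theta\varepsilon\,\phi(2-2i/N),&3N/4\le i\le N.\end{cases}$$ The choice $\phi(t)=2t\ln N$ gives the Shishkin mesh $\Delta_S$, and $\phi(t)=-\ln(1-2t(1-2/N))$ gives the exponential (eXp) mesh $\Delta_{\rm eXp}$. Let $\mathcal S^1_0(\Delta)$ be the space of functions in $H^1_0(I)$ that are affine on each interval of the mesh $\Delta$. **Theorem.** There are constants $C>0$ and $\tilde C>0$, independent of $\varepsilon$ and $N$, such that for every $\varepsilon\in(0,1]$ and every integer $N$ with $1\le N\le1/\varepsilon$ there are ReLU networks $\Phi^{S,N}_\varepsilon$ and $\Phi^{{\rm eXp},N}_\varepsilon$ with input and output dimension $1$, depth $2$ and width $N+1$, whose realizations lie in $H^1(I)$ and satisfy $$\varepsilon\|u_\varepsilon'-\mathrm R(\Phi^{S,N}_\varepsilon)'\|_{L^2(I)}+\|u_\varepsilon-\mathrm R(\Phi^{S,N}_\varepsilon)\|_{L^2(I)}\le C N^{-1}(1+\log N),$$ $$\varepsilon\|u_\varepsilon'-\mathrm R(\Phi^{{\rm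 eXp},N}_\varepsilon)'\|_{L^2(I)}+\|u_\varepsilon-\mathrm R(\Phi^{{\rm eXp},N}_\varepsilon)\|_{L^2(I)}\le C N^{-1},$$ $$\mathrm R(\Phi^{S,N}_\varepsilon)(\pm1)=0=\mathrm R(\Phi^{{\rm eXp},N}_\varepsilon)(\pm1),\qquad M(\Phi^{S,N}_\varepsilon)+M(\Phi^{{\rm eXp},N}_\varepsilon)\le\tilde C N.$$ The weights and biases in the hidden layer of $\Phi^{S,N}_\varepsilon$ depend only on $\varepsilon$, $N$ and the fixed lower bound $\underline b$, and not on $b$, $f$, $u_\varepsilon$. Whenever $4\mid N$ and $\theta\varepsilon\ln N<1/4$, one has $\mathrm R(\Phi^{S,N}_\varepsilon)|_I\in\mathcal S^1_0(\Delta_S)$ and $\mathrm R(\Phi^{{\rm eXp},N}_\varepsilon)|_I\in\mathcal S^1_0(\Delta_{\rm eXp})$. -/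

import Mathlib

open MeasureTheory Set
open scoped ContDiff

noncomputable section

namespace SingPert

/-! ### Sobolev spaces on the interval `I = (-1,1)`

Elements of `L²(I)` and `Hᵏ(I)` are represented by functions `ℝ → ℝ`, of which only the values
almost everywhere on `I` matter. -/

/-- Lebesgue measure on `I = (-1,1)`. -/
def volI : Measure ℝ := volume.restrict (Ioo (-1) 1)

/-- `g` is a weak derivative of `u` on `I`. -/
def IsWeakDeriv (u g : ℝ → ℝ) : Prop :=
  LocallyIntegrableOn u (Ioo (-1) 1) ∧ LocallyIntegrableOn g (Ioo (-1) 1) ∧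
    ∀ φ : ℝ → ℝ, ContDiff ℝ ∞ φ → HasCompactSupport φ → tsupport φ ⊆ Ioo (-1) 1 →
      ∫ x, u x * deriv φ x ∂volI = -∫ x, g x * φ x ∂volI

/-- `u ∈ Hᵏ(I) = W^{k,2}(I)`. -/
def MemH : ℕ → (ℝ → ℝ) → Prop
  | 0, u => MemLp u 2 volI
  | k + 1, u => MemLp u 2 volI ∧ ∃ g : ℝ → ℝ, IsWeakDeriv u g ∧ MemH k g

/-- `u ∈ H¹₀(I)`: the continuous representative of `u` on `[-1,1]` vanishes at `±1`. -/
def MemH10 (u : ℝ → ℝ) : Prop :=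
  MemH 1 u ∧ ∃ v : ℝ → ℝ, ContinuousOn v (Icc (-1) 1) ∧ u =ᵐ[volI] v ∧ v (-1) = 0 ∧ v 1 = 0

open Classical in
/-- The weak derivative in `L²(I)` of a function of `H¹(I)` (it is unique up to null sets). -/
def weakDeriv (u : ℝ → ℝ) : ℝ → ℝ :=
  if h : ∃ g : ℝ → ℝ, MemLp g 2 volI ∧ IsWeakDeriv u g then h.choose else 0

/-- The bilinear form `B_ε(w,v) = ∫_I ε² w' v' + b w v`. -/
def bilin (ε : ℝ) (b w v : ℝ → ℝ) : ℝ :=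
  ∫ x, (ε ^ 2 * weakDeriv w x * weakDeriv v x + b x * w x * v x) ∂volI

/-- `u ∈ H¹₀(I)` solves `-ε² u'' + b u = f` in `I`, `u(±1) = 0`, in the weak sense. -/
def IsWeakSolution (ε : ℝ) (b f u : ℝ → ℝ) : Prop :=
  MemH10 u ∧ ∀ v : ℝ → ℝ, MemH10 v → bilin ε b u v = ∫ x, f x * v x ∂volI

/-- The balanced error `ε ‖u' - v'‖_{L²(I)} + ‖u - v‖_{L²(I)}`, with values in `[0,∞]`. -/
def errorNorm (ε : ℝ) (u v : ℝ → ℝ) : ENNReal :=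
  ENNReal.ofReal ε * eLpNorm (fun x => weakDeriv u x - weakDeriv v x) 2 volI
    + eLpNorm (fun x => u x - v x) 2 volI

/-! ### Layer-adapted meshes -/

/-- The `i`-th node, `0 ≤ i ≤ N` with `4 ∣ N`, of the S-type mesh on `[-1,1]` with
mesh-generating function `φ` and transition points `±(1 - lam)`, `lam = θ ε φ(1/2)`. -/
def sTypeNode (θ ε : ℝ) (φ : ℝ → ℝ) (N i : ℕ) : ℝ :=
  let lam := θ * ε * φ (1 / 2)
  if 4 * i ≤ N then -1 + θ * ε * φ (2 * i / N)
  else if 4 * i ≤ 3 * N then 4 * i / N * (1 - lam) - 2 + 2 * lam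
  else 1 - θ * ε * φ (2 - 2 * i / N)

/-- Nodes of the Shishkin mesh, generated by `φ(t) = 2 t ln N`. -/
def shishkinNode (θ ε : ℝ) (N : ℕ) : ℕ → ℝ :=
  sTypeNode θ ε (fun t => 2 * t * Real.log N) N

/-- Nodes of the exponential (eXp) mesh, generated by `φ(t) = -ln(1 - 2t(1 - 2/N))`. -/
def expNode (θ ε : ℝ) (N : ℕ) : ℕ → ℝ :=
  sTypeNode θ ε (fun t => -Real.log (1 - 2 * t * (1 - 2 / N))) N

/-- The mesh parameter `θ = 2 β_*`, `β_* = 2 / √bLow`, `bLow` the lower bound of the reaction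
coefficient. -/
def meshTheta (bLow : ℝ) : ℝ := 2 * (2 / Real.sqrt bLow)

/-- `v ∈ S¹₀(Δ)`: `v` belongs to `H¹₀(I)` and is affine on each of the `N` closed intervals of the
mesh `Δ` with nodes `x 0 < ... < x N`. -/
def MemS10 (N : ℕ) (x : ℕ → ℝ) (v : ℝ → ℝ) : Prop :=
  MemH10 v ∧ ∀ j < N, ∃ p q : ℝ, ∀ t ∈ Icc (x j) (x (j + 1)), v t = p * t + q

/-! ### Feedforward neural networks -/

/-- Neural network configurations `((A₁,b₁),…,(A_L,b_L))`, `L ≥ 1`, with input dimension `d` and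
output dimension `m`: either the last layer alone, or a first hidden layer with `n ≥ 1` neurons
followed by the remaining layers. -/
inductive NN : ℕ → ℕ → Type
  | output {d m : ℕ} (A : Matrix (Fin m) (Fin d) ℝ) (b : Fin m → ℝ) : NN d m
  | hidden {d n m : ℕ} (hn : 0 < n) (A : Matrix (Fin n) (Fin d) ℝ) (b : Fin n → ℝ)
      (Φ : NN n m) : NN d m

namespace NN

/-- Realization with activation `ρ`, which acts componentwise on the hidden layers. -/
def realize (ρ : ℝ → ℝ) : {d m : ℕ} → NN d m → (Fin d → ℝ) → (Fin m → ℝ)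
  | _, _, .output A b, x => A.mulVec x + b
  | _, _, .hidden _ A b Φ, x => Φ.realize ρ (fun i => ρ ((A.mulVec x + b) i))

/-- The depth `L(Φ)`: the number of layers. -/
def depth : {d m : ℕ} → NN d m → ℕ
  | _, _, .output _ _ => 1
  | _, _, .hidden _ _ _ Φ => Φ.depth + 1

/-- The width `W(Φ) = max_{1 ≤ ℓ ≤ L} N_ℓ`. -/
def width : {d m : ℕ} → NN d m → ℕ
  | _, m, .output _ _ => m
  | _, _, .hidden (n := n) _ _ _ Φ => max n Φ.width

/-- The number of nonzero entries of a matrix and of a vector. -/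
def layerSize {d m : ℕ} (A : Matrix (Fin m) (Fin d) ℝ) (b : Fin m → ℝ) : ℕ :=
  {p : Fin m × Fin d | A p.1 p.2 ≠ 0}.ncard + {i : Fin m | b i ≠ 0}.ncard

/-- The size `M(Φ)`: the number of nonzero weights and biases. -/
def size : {d m : ℕ} → NN d m → ℕ
  | _, _, .output A b => layerSize A b
  | _, _, .hidden _ A b Φ => layerSize A b + Φ.size

/-- The class of networks of depth `L`, width `W`, input dimension `d` and output dimension `m`. -/
def ofClass (L W d m : ℕ) : Set (NN d m) := {Φ | Φ.depth = L ∧ Φ.width = W}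

end NN

/-- The ReLU activation. -/
def relu (x : ℝ) : ℝ := max 0 x

/-- The ReLU realization of a network with one input and one output, as a function `ℝ → ℝ`. -/
def real1 (Φ : NN 1 1) : ℝ → ℝ := fun t => Φ.realize relu (fun _ => t) 0

end SingPert

end

noncomputable section

namespace SingPert

/-! ### Absolutely continuous representatives of Sobolev functions -/

/-! Data in `H¹` suffice, because the target rate is only first order and `N ≤ 1/ε` means that every
`O(ε)` error is already `O(1/N)`. Hence no derivative bounds for `u` are needed. With absolutely
continuous representatives `B`, `F` of `b`, `f`, the solution is compared with `U = G + W`. Here `G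
= F / B` is the reduced solution, and `W` consists of two explicit exponentials that correct the
boundary values of `G`, plus an affine function of size `O(ε)` that makes these corrections exact.

The exponentials have the frozen rates `√B(±1) / ε`, so they leave the residual `(B(x) - B(±1))
exp(-a d)`, with `d` the distance to the end point and `a` the rate. As `B` is Hölder continuous of
order 1/2, its `L²` norm is `O(1/a) = O(ε)`. The term `ε² G'` is kept in divergence form, where it
also costs only `O(ε)`. Coercivity (`energy_estimate`) turns this into an `O(ε)` error in the energy
norm (`asymptotic_expansion`).

What remains is to interpolate `U` on the mesh. For `G` the interpolation error is `O(h)` in `L²`,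
and its derivative is merely bounded but carries the factor `ε`. An exponential is monotone, so on a
cell its interpolation error is at most its oscillation `κ`, and the error of its derivative is at
most rate times `κ`, that is `O(κ / ε)`. The mesh therefore enters only through the oscillations
recorded in `LayerMesh`: `N⁻¹(1 + log N)` on the Shishkin mesh (`shishkinNode_layerMesh`) and `N⁻¹`
on the eXp mesh (`expNode_layerMesh`).

A piecewise affine function that vanishes at its first node is a sum of shifted ReLUs whose shifts
are the nodes. So the hidden layer sees only the mesh, and the data enter through the output
weights. For general `N` the mesh has `4⌊N/4⌋` cells and the remaining neurons get output weight
zero. If `N < 4`, or if the layers are too wide for the mesh, then `N` is bounded and the zero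
function already achieves the rate (`energy_bound`, `le_of_layer_wide`). -/

theorem uIcc_I : uIcc (-1 : ℝ) 1 = Icc (-1) 1 := uIcc_of_le (by norm_num)

instance : IsFiniteMeasure volI := by
  unfold volI; infer_instance

theorem integrable_restrict_I {f : ℝ → ℝ} (h : Integrable f) : Integrable f volI := h.restrict

theorem integral_volI (f : ℝ → ℝ) : ∫ x, f x ∂volI = ∫ x in (-1 : ℝ)..1, f x := by
  rw [intervalIntegral.integral_of_le (by norm_num), volI, integral_Ioc_eq_integral_Ioo]

theorem ae_volI_of_ae_mem {p : ℝ → Prop} (h : ∀ᵐ x, x ∈ Icc (-1 : ℝ) 1 → p x) :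
    ∀ᵐ x ∂volI, p x := by
  rw [volI, ae_restrict_iff' measurableSet_Ioo]
  filter_upwards [h] with x hx hxI using hx (Ioo_subset_Icc_self hxI)

theorem ae_volI_of_forall {p : ℝ → Prop} (h : ∀ x ∈ Icc (-1 : ℝ) 1, p x) : ∀ᵐ x ∂volI, p x :=
  ae_volI_of_ae_mem (Filter.Eventually.of_forall h)

theorem integrable_volI_iff {f : ℝ → ℝ} :
    Integrable f volI ↔ IntervalIntegrable f volume (-1) 1 := by
  rw [intervalIntegrable_iff_integrableOn_Ioo_of_le (by norm_num)]; rfl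

theorem LocallyIntegrableOn.integrable_volI_mul {g φ : ℝ → ℝ}
    (hg : LocallyIntegrableOn g (Ioo (-1) 1)) (hφ : Continuous φ) (hc : HasCompactSupport φ)
    (hs : tsupport φ ⊆ Ioo (-1) 1) : Integrable (fun x => g x * φ x) := by
  have h1 : IntegrableOn (fun x => g x * φ x) (tsupport φ) :=
    (hg.integrableOn_compact_subset hs hc).mul_continuousOn hφ.continuousOn hc
  rwa [integrableOn_iff_integrable_of_support_subset] at h1
  intro x hx
  exact subset_tsupport φ (fun h => hx (by simp [h]))

theorem integral_volI_mul_test {g φ : ℝ → ℝ} (hs : tsupport φ ⊆ Ioo (-1) 1) :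
    ∫ x, g x * φ x ∂volI = ∫ x, g x * φ x := by
  rw [volI]
  refine setIntegral_eq_integral_of_forall_compl_eq_zero fun x hx => ?_
  rw [image_eq_zero_of_notMem_tsupport fun h => hx (hs h), mul_zero]

theorem ae_eq_zero_of_integral_test {g : ℝ → ℝ} (hg : LocallyIntegrableOn g (Ioo (-1) 1))
    (h : ∀ φ : ℝ → ℝ, ContDiff ℝ ∞ φ → HasCompactSupport φ → tsupport φ ⊆ Ioo (-1) 1 →
      ∫ x, g x * φ x ∂volI = 0) : ∀ᵐ x ∂volI, g x = 0 := by
  rw [volI, ae_restrict_iff' measurableSet_Ioo]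
  refine isOpen_Ioo.ae_eq_zero_of_integral_contDiff_smul_eq_zero hg fun φ h1 h2 h3 => ?_
  rw [← h φ h1 h2 h3, integral_volI_mul_test h3]
  simp [mul_comm]

theorem IsWeakDeriv.ae_eq {u g g' : ℝ → ℝ} (h : IsWeakDeriv u g) (h' : IsWeakDeriv u g') :
    g =ᵐ[volI] g' := by
  have := ae_eq_zero_of_integral_test (h.2.1.sub h'.2.1) fun φ h1 h2 h3 => by
    have e1 := h.2.2 φ h1 h2 h3
    have e2 := h'.2.2 φ h1 h2 h3
    have i1 := LocallyIntegrableOn.integrable_volI_mul h.2.1 h1.continuous h2 h3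
    have i2 := LocallyIntegrableOn.integrable_volI_mul h'.2.1 h1.continuous h2 h3
    simp only [Pi.sub_apply, sub_mul]
    rw [integral_sub (integrable_restrict_I i1) (integrable_restrict_I i2)]
    linarith
  filter_upwards [this] with x hx
  simpa [sub_eq_zero] using hx

theorem LocallyIntegrableOn.congr_volI {u v : ℝ → ℝ} (h : u =ᵐ[volI] v)
    (hu : LocallyIntegrableOn u (Ioo (-1) 1)) : LocallyIntegrableOn v (Ioo (-1) 1) := by
  rw [locallyIntegrableOn_iff isOpen_Ioo.isLocallyClosed] at hu ⊢
  intro k hk hkc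
  exact (hu k hk hkc).congr_fun_ae (ae_restrict_of_ae_restrict_of_subset hk h)

theorem IsWeakDeriv.congr {u v g : ℝ → ℝ} (h : IsWeakDeriv u g) (huv : u =ᵐ[volI] v) :
    IsWeakDeriv v g := by
  refine ⟨LocallyIntegrableOn.congr_volI huv h.1, h.2.1, fun φ h1 h2 h3 => ?_⟩
  rw [← h.2.2 φ h1 h2 h3]
  refine integral_congr_ae ?_
  filter_upwards [huv] with x hx
  rw [hx]

theorem locallyIntegrableOn_of_integrable_volI {g : ℝ → ℝ} (hg : Integrable g volI) :
    LocallyIntegrableOn g (Ioo (-1) 1) :=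
  IntegrableOn.locallyIntegrableOn hg

/-- An absolutely continuous function on `[-1,1]` with square integrable derivative. -/
def IsAC (v : ℝ → ℝ) : Prop :=
  AbsolutelyContinuousOnInterval v (-1) 1 ∧ MemLp (deriv v) 2 volI

theorem ac_continuousOn {v : ℝ → ℝ} (h : AbsolutelyContinuousOnInterval v (-1) 1) :
    ContinuousOn v (Icc (-1) 1) := uIcc_I ▸ h.continuousOn

theorem ac_integrable {v : ℝ → ℝ} (h : AbsolutelyContinuousOnInterval v (-1) 1) :
    Integrable v volI :=
  integrable_volI_iff.2 h.continuousOn.intervalIntegrable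

theorem ac_isWeakDeriv {v : ℝ → ℝ} (h : AbsolutelyContinuousOnInterval v (-1) 1) :
    IsWeakDeriv v (deriv v) := by
  refine ⟨locallyIntegrableOn_of_integrable_volI (ac_integrable h),
    locallyIntegrableOn_of_integrable_volI (integrable_volI_iff.2 h.intervalIntegrable_deriv),
    fun φ h1 h2 h3 => ?_⟩
  have hφ : AbsolutelyContinuousOnInterval φ (-1) 1 :=
    (h1.of_le (by norm_cast)).contDiffOn.absolutelyContinuousOnInterval
  have e1 : φ 1 = 0 := image_eq_zero_of_notMem_tsupport fun h => by simpa using h3 h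
  have e2 : φ (-1) = 0 := image_eq_zero_of_notMem_tsupport fun h => by simpa using h3 h
  rw [integral_volI, integral_volI, h.integral_mul_deriv_eq_deriv_mul hφ, e1, e2]
  simp

theorem ac_sub_eq_integral {v : ℝ → ℝ} (h : AbsolutelyContinuousOnInterval v (-1) 1) {x y : ℝ}
    (hx : x ∈ Icc (-1 : ℝ) 1) (hy : y ∈ Icc (-1 : ℝ) 1) :
    ∫ t in x..y, deriv v t = v y - v x :=
  (h.mono (by rw [uIcc_I]; exact uIcc_subset_Icc hx hy)).integral_deriv_eq_sub

theorem bump_exists : ∃ ψ : ℝ → ℝ, ContDiff ℝ ∞ ψ ∧ HasCompactSupport ψ ∧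
    tsupport ψ ⊆ Ioo (-1) 1 ∧ ∫ x, ψ x = 1 := by
  let f : ContDiffBump (0 : ℝ) := ⟨1 / 4, 1 / 2, by norm_num, by norm_num⟩
  refine ⟨f.normed volume, f.contDiff_normed, f.hasCompactSupport_normed, ?_, f.integral_normed⟩
  rw [f.tsupport_normed_eq]
  intro x hx
  simp only [Metric.mem_closedBall, dist_zero_right, Real.norm_eq_abs, f] at hx
  rw [abs_le] at hx
  constructor <;> linarith [hx.1, hx.2]

/-- A test function of mean zero has a test function as primitive. -/
theorem exists_primitive_test {h : ℝ → ℝ} (h1 : ContDiff ℝ ∞ h) (h2 : HasCompactSupport h)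
    (h3 : tsupport h ⊆ Ioo (-1) 1) (h0 : ∫ x, h x = 0) :
    ∃ φ : ℝ → ℝ, ContDiff ℝ ∞ φ ∧ HasCompactSupport φ ∧ tsupport φ ⊆ Ioo (-1) 1 ∧
      deriv φ = h := by
  have hd : ∀ x, HasDerivAt (fun x => ∫ t in (-1 : ℝ)..x, h t) (h x) x := fun x =>
    intervalIntegral.integral_hasDerivAt_right (h1.continuous.intervalIntegrable _ _)
      (h1.continuous.stronglyMeasurableAtFilter _ _) h1.continuous.continuousAt
  have hderiv : deriv (fun x => ∫ t in (-1 : ℝ)..x, h t) = h := funext fun x => (hd x).deriv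
  obtain ⟨a, b, ha, hb, hab⟩ : ∃ a b : ℝ, -1 < a ∧ b < 1 ∧ tsupport h ⊆ Icc a b := by
    rcases (tsupport h).eq_empty_or_nonempty with he | hne
    · exact ⟨0, 0, by norm_num, by norm_num, by simp [he]⟩
    · have hK : IsCompact (tsupport h) := h2
      exact ⟨sInf (tsupport h), sSup (tsupport h), (h3 (hK.sInf_mem hne)).1,
        (h3 (hK.sSup_mem hne)).2,
        fun x hx => ⟨csInf_le hK.bddBelow hx, le_csSup hK.bddAbove hx⟩⟩
  have hz : ∀ x, x ∉ Icc a b → h x = 0 := fun x hx =>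
    image_eq_zero_of_notMem_tsupport fun h => hx (hab h)
  have hsupp : Function.support (fun x => ∫ t in (-1 : ℝ)..x, h t) ⊆ Icc a b := by
    intro x hx
    by_contra hxab
    apply hx
    rw [mem_Icc, not_and_or, not_le, not_le] at hxab
    -- To the left of `a` the integrand vanishes; to the right of `b` the whole integral of `h` has
    -- been collected, and it is zero.
    rcases hxab with hxa | hxb
    · refine intervalIntegral.integral_zero_ae (Filter.Eventually.of_forall fun t ht => ?_)
      refine hz t fun htab => ?_
      have := ht.2
      rw [mem_Icc] at htab
      rcases le_max_iff.1 this with h | h <;> linarith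
    · rw [← h0]
      refine intervalIntegral.integral_eq_integral_of_support_subset fun t ht => ?_
      have : t ∈ Icc a b := by
        by_contra hc
        exact ht (hz t hc)
      exact ⟨by linarith [this.1], by linarith [this.2]⟩
  have hts : tsupport (fun x => ∫ t in (-1 : ℝ)..x, h t) ⊆ Icc a b :=
    closure_minimal hsupp isClosed_Icc
  refine ⟨fun x => ∫ t in (-1 : ℝ)..x, h t, ?_, ?_, ?_, hderiv⟩
  · rw [contDiff_infty_iff_deriv, hderiv]
    exact ⟨fun x => (hd x).differentiableAt, h1⟩
  · exact isCompact_Icc.of_isClosed_subset (isClosed_tsupport _) hts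
  · exact hts.trans fun x hx => ⟨by linarith [hx.1], by linarith [hx.2]⟩

/-- The du Bois-Reymond lemma: a function with vanishing weak derivative is constant. -/
theorem ae_const_of_integral_deriv {z : ℝ → ℝ} (hz : LocallyIntegrableOn z (Ioo (-1) 1))
    (h : ∀ φ : ℝ → ℝ, ContDiff ℝ ∞ φ → HasCompactSupport φ → tsupport φ ⊆ Ioo (-1) 1 →
      ∫ x, z x * deriv φ x ∂volI = 0) : ∃ c : ℝ, ∀ᵐ x ∂volI, z x = c := by
  obtain ⟨ψ, p1, p2, p3, p4⟩ := bump_exists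
  set c : ℝ := ∫ x, z x * ψ x ∂volI with hc
  refine ⟨c, ?_⟩
  have hzc : LocallyIntegrableOn (fun x => z x - c) (Ioo (-1) 1) :=
    hz.sub ((locallyIntegrable_const c).locallyIntegrableOn _)
  have := ae_eq_zero_of_integral_test hzc fun η h1 h2 h3 => by
    set d : ℝ := ∫ x, η x with hd
    have ts : tsupport (fun x => η x - d * ψ x) ⊆ tsupport η ∪ tsupport ψ := by
      refine closure_minimal (fun x hx => ?_) ((isClosed_tsupport _).union (isClosed_tsupport _))
      by_contra hcon
      rw [mem_union, not_or] at hcon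
      apply hx
      simp [image_eq_zero_of_notMem_tsupport hcon.1, image_eq_zero_of_notMem_tsupport hcon.2]
    have iη : Integrable η := h1.continuous.integrable_of_hasCompactSupport h2
    have iψ : Integrable ψ := p1.continuous.integrable_of_hasCompactSupport p2
    -- Subtracting `d` times the normalized bump makes an arbitrary test function mean-free, hence
    -- the derivative of an admissible one.
    obtain ⟨φ, f1, f2, f3, f4⟩ := exists_primitive_test (h := fun x => η x - d * ψ x)
      (h1.sub (contDiff_const.mul p1))
      ((h2.isCompact.union p2.isCompact).of_isClosed_subset (isClosed_tsupport _) ts)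
      (ts.trans (union_subset h3 p3))
      (by rw [integral_sub iη (iψ.const_mul d), integral_const_mul, p4]; simp [hd])
    have e := h φ f1 f2 f3
    have jη := LocallyIntegrableOn.integrable_volI_mul hz h1.continuous h2 h3
    have jψ := LocallyIntegrableOn.integrable_volI_mul hz p1.continuous p2 p3
    have e2 : ∀ x, z x * deriv φ x = z x * η x - d * (z x * ψ x) := fun x => by rw [f4]; ring
    simp only [e2] at e
    rw [integral_sub (integrable_restrict_I jη) ((integrable_restrict_I jψ).const_mul d), integral_const_mul, ← hc] at e
    have e3 : ∀ x, (z x - c) * η x = z x * η x - c * η x := fun x => by ring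
    simp only [e3]
    have e4 : ∫ x, c * η x ∂volI = c * d := by
      rw [integral_volI_mul_test (g := fun _ => c) h3, integral_const_mul]
    rw [integral_sub (integrable_restrict_I jη) ((integrable_restrict_I iη).const_mul c), e4]
    linarith
  filter_upwards [this] with x hx
  linarith

/-- The primitive of `g` has weak derivative `g`, so by du Bois-Reymond it differs from `u` by a
constant. This allows weak derivatives to be replaced by classical a.e. derivatives from here on. -/
theorem exists_ac_of_isWeakDeriv {u g : ℝ → ℝ} (h : IsWeakDeriv u g) (hg : MemLp g 2 volI) :
    ∃ v : ℝ → ℝ, IsAC v ∧ u =ᵐ[volI] v ∧ deriv v =ᵐ[volI] g := by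
  have gi : IntervalIntegrable g volume (-1) 1 :=
    integrable_volI_iff.1 (hg.integrable (by norm_num))
  have wac := gi.absolutelyContinuousOnInterval_intervalIntegral (c := -1) (by simp)
  set w : ℝ → ℝ := fun x => ∫ t in (-1 : ℝ)..x, g t
  have wd : deriv w =ᵐ[volI] g := by
    refine ae_volI_of_ae_mem ?_
    filter_upwards [gi.ae_hasDerivAt_integral] with x hx hxI
    exact (hx (uIcc_I ▸ hxI) (-1) (by simp)).deriv
  have wW := ac_isWeakDeriv wac
  obtain ⟨c, hc⟩ := ae_const_of_integral_deriv (h.1.sub wW.1) fun φ h1 h2 h3 => by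
    have hφ' : ContDiff ℝ ∞ (deriv φ) := (contDiff_infty_iff_deriv.1 h1).2
    have s' : tsupport (deriv φ) ⊆ Ioo (-1) 1 :=
      (closure_minimal support_deriv_subset (isClosed_tsupport φ)).trans h3
    have i1 := LocallyIntegrableOn.integrable_volI_mul h.1 hφ'.continuous h2.deriv s'
    have i2 := LocallyIntegrableOn.integrable_volI_mul wW.1 hφ'.continuous h2.deriv s'
    simp only [Pi.sub_apply, sub_mul]
    rw [integral_sub (integrable_restrict_I i1) (integrable_restrict_I i2), h.2.2 φ h1 h2 h3, wW.2.2 φ h1 h2 h3]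
    rw [integral_congr_ae (g := fun x => deriv w x * φ x)]
    · ring
    · filter_upwards [wd] with x hx
      rw [hx]
  have hderiv : deriv (fun x => c + w x) = deriv w := by
    funext x; exact deriv_const_add c
  refine ⟨fun x => c + w x, ⟨?_, ?_⟩, ?_, ?_⟩
  · refine AbsolutelyContinuousOnInterval.fun_add ?_ wac
    exact (contDiff_const (n := 1)).contDiffOn.absolutelyContinuousOnInterval
  · rw [hderiv]; exact (memLp_congr_ae wd).2 hg
  · filter_upwards [hc] with x hx
    simp only [Pi.sub_apply] at hx
    linarith
  · rw [hderiv]; exact wd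

theorem MemH.exists_ac {u : ℝ → ℝ} (h : MemH 1 u) : ∃ v : ℝ → ℝ, IsAC v ∧ u =ᵐ[volI] v := by
  obtain ⟨-, g, hg, hL⟩ := h
  obtain ⟨v, h1, h2, -⟩ := exists_ac_of_isWeakDeriv hg hL
  exact ⟨v, h1, h2⟩

theorem MemH.one_of_two {u : ℝ → ℝ} (h : MemH 2 u) : MemH 1 u := by
  obtain ⟨h1, g, hg, hL, -⟩ := h
  exact ⟨h1, g, hg, hL⟩

theorem IsAC.memLp {v : ℝ → ℝ} (h : IsAC v) : MemLp v 2 volI := by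
  obtain ⟨C, hC⟩ := h.1.exists_bound
  refine MemLp.of_bound (ac_integrable h.1).aestronglyMeasurable C (ae_volI_of_forall ?_)
  rwa [uIcc_I] at hC

theorem IsAC.memH {v : ℝ → ℝ} (h : IsAC v) : MemH 1 v :=
  ⟨h.memLp, deriv v, ac_isWeakDeriv h.1, h.2⟩

theorem IsAC.memH10 {v : ℝ → ℝ} (h : IsAC v) (h0 : v (-1) = 0) (h1 : v 1 = 0) : MemH10 v :=
  ⟨h.memH, v, ac_continuousOn h.1, Filter.EventuallyEq.rfl, h0, h1⟩

theorem weakDeriv_ae_eq {u v : ℝ → ℝ} (hv : IsAC v) (h : u =ᵐ[volI] v) :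
    weakDeriv u =ᵐ[volI] deriv v := by
  have hw : IsWeakDeriv u (deriv v) := (ac_isWeakDeriv hv.1).congr h.symm
  have hex : ∃ g : ℝ → ℝ, MemLp g 2 volI ∧ IsWeakDeriv u g := ⟨_, hv.2, hw⟩
  rw [weakDeriv, dif_pos hex]
  exact hex.choose_spec.2.ae_eq hw

theorem eqOn_Icc_of_ae_eq {v w : ℝ → ℝ} (hv : ContinuousOn v (Icc (-1) 1))
    (hw : ContinuousOn w (Icc (-1) 1)) (h : v =ᵐ[volI] w) : EqOn v w (Icc (-1) 1) := by
  refine Measure.eqOn_Icc_of_ae_eq (μ := volume) (by norm_num) ?_ hv hw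
  rw [volI] at h
  rwa [← restrict_Ioo_eq_restrict_Icc]

/-- Two continuous functions that agree a.e. agree up to the end points, which transfers the
boundary values to the absolutely continuous representative. -/
theorem MemH10.exists_ac {u : ℝ → ℝ} (h : MemH10 u) :
    ∃ v : ℝ → ℝ, IsAC v ∧ u =ᵐ[volI] v ∧ v (-1) = 0 ∧ v 1 = 0 := by
  obtain ⟨h1, w, hw, huw, w0, w1⟩ := h
  obtain ⟨v, hv, huv⟩ := h1.exists_ac
  have := eqOn_Icc_of_ae_eq (ac_continuousOn hv.1) hw (huv.symm.trans huw)
  exact ⟨v, hv, huv, by rw [this (by simp), w0], by rw [this (by simp), w1]⟩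

theorem ac_comp_of_dist_le {f g : ℝ → ℝ} {a b K : ℝ} (hg : AbsolutelyContinuousOnInterval g a b)
    (h : ∀ x ∈ uIcc a b, ∀ y ∈ uIcc a b, dist (f x) (f y) ≤ K * dist (g x) (g y)) :
    AbsolutelyContinuousOnInterval f a b := by
  unfold AbsolutelyContinuousOnInterval at hg ⊢
  refine squeeze_zero' ?_ ?_ (by simpa using hg.const_mul K)
  · exact Filter.Eventually.of_forall fun _ => Finset.sum_nonneg fun i hi => dist_nonneg
  rw [Filter.eventually_inf_principal]
  filter_upwards with E hE
  rw [Finset.mul_sum]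
  exact Finset.sum_le_sum fun i hi => h _ (hE.1 i hi).1 _ (hE.1 i hi).2

/-! ### Energy estimate -/

theorem integrable_mul_of_memLp_two {f g : ℝ → ℝ} (hf : MemLp f 2 volI) (hg : MemLp g 2 volI) :
    Integrable (fun x => f x * g x) volI :=
  MemLp.integrable_mul (p := 2) (q := 2) hf hg

theorem integrable_sq_of_memLp_two {f : ℝ → ℝ} (hf : MemLp f 2 volI) :
    Integrable (fun x => f x ^ 2) volI := by
  simpa only [sq] using integrable_mul_of_memLp_two hf hf

theorem memLp_bounded_mul {b g : ℝ → ℝ} {C : ℝ} (hb : AEStronglyMeasurable b volI)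
    (hC : ∀ᵐ x ∂volI, |b x| ≤ C) (hg : MemLp g 2 volI) : MemLp (fun x => b x * g x) 2 volI := by
  refine MemLp.of_le_mul (c := C) hg (hb.mul hg.aestronglyMeasurable) ?_
  filter_upwards [hC] with x hx
  rw [norm_mul, Real.norm_eq_abs]
  gcongr

theorem ac_of_contDiff {v : ℝ → ℝ} (hv : ContDiff ℝ 1 v) :
    AbsolutelyContinuousOnInterval v (-1) 1 :=
  hv.contDiffOn.absolutelyContinuousOnInterval

theorem memLp_of_continuous {v : ℝ → ℝ} (hv : Continuous v) : MemLp v 2 volI := by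
  obtain ⟨C, hC⟩ := isCompact_Icc.exists_bound_of_continuousOn
    (hv.continuousOn (s := Icc (-1 : ℝ) 1))
  exact MemLp.of_bound hv.aestronglyMeasurable C (ae_volI_of_forall hC)

theorem isAC_of_contDiff {v : ℝ → ℝ} (hv : ContDiff ℝ 1 v) : IsAC v :=
  ⟨ac_of_contDiff hv, memLp_of_continuous (hv.continuous_deriv (le_refl _))⟩

theorem deriv_add_ae {v w : ℝ → ℝ} (hv : AbsolutelyContinuousOnInterval v (-1) 1)
    (hw : AbsolutelyContinuousOnInterval w (-1) 1) :
    deriv (fun x => v x + w x) =ᵐ[volI] fun x => deriv v x + deriv w x := by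
  refine ae_volI_of_ae_mem ?_
  filter_upwards [hv.ae_differentiableAt, hw.ae_differentiableAt] with x h1 h2 hx
  rw [← uIcc_I] at hx
  exact deriv_fun_add (h1 hx) (h2 hx)

theorem deriv_sub_ae {v w : ℝ → ℝ} (hv : AbsolutelyContinuousOnInterval v (-1) 1)
    (hw : AbsolutelyContinuousOnInterval w (-1) 1) :
    deriv (fun x => v x - w x) =ᵐ[volI] fun x => deriv v x - deriv w x := by
  refine ae_volI_of_ae_mem ?_
  filter_upwards [hv.ae_differentiableAt, hw.ae_differentiableAt] with x h1 h2 hx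
  rw [← uIcc_I] at hx
  exact deriv_fun_sub (h1 hx) (h2 hx)

theorem IsAC.add {v w : ℝ → ℝ} (hv : IsAC v) (hw : IsAC w) : IsAC fun x => v x + w x :=
  ⟨hv.1.fun_add hw.1, (memLp_congr_ae (deriv_add_ae hv.1 hw.1)).2 (hv.2.add hw.2)⟩

theorem IsAC.sub {v w : ℝ → ℝ} (hv : IsAC v) (hw : IsAC w) : IsAC fun x => v x - w x :=
  ⟨hv.1.fun_sub hw.1, (memLp_congr_ae (deriv_sub_ae hv.1 hw.1)).2 (hv.2.sub hw.2)⟩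

/-- Testing the difference of the two equations with `e = v - U` bounds the energy of `e` by the
residual functional, and Young's inequality absorbs half of that energy. The residual is split into
a flux part `ε² P`, tested with `e'`, and an `L²` part `R`, so that `U` needs no second derivative.
-/
theorem energy_estimate {ε bLow bUp : ℝ} {b f u v U P R : ℝ → ℝ} (hbLow : 0 < bLow)
    (hb : AEStronglyMeasurable b volI) (hbb : ∀ᵐ x ∂volI, bLow ≤ b x ∧ b x ≤ bUp)
    (hf : MemLp f 2 volI) (hu : IsWeakSolution ε b f u)
    (hv : IsAC v) (huv : u =ᵐ[volI] v) (v0 : v (-1) = 0) (v1 : v 1 = 0)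
    (hU : IsAC U) (U0 : U (-1) = 0) (U1 : U 1 = 0)
    (hP : MemLp P 2 volI) (hR : MemLp R 2 volI)
    (hres : ∀ e : ℝ → ℝ, IsAC e → e (-1) = 0 → e 1 = 0 →
      ∫ x, (ε ^ 2 * deriv U x * deriv e x + b x * U x * e x - f x * e x) ∂volI =
        ∫ x, (ε ^ 2 * P x * deriv e x + R x * e x) ∂volI) :
    ε ^ 2 * ∫ x, (deriv v x - deriv U x) ^ 2 ∂volI + bLow * ∫ x, (v x - U x) ^ 2 ∂volI
      ≤ ε ^ 2 * ∫ x, P x ^ 2 ∂volI + (∫ x, R x ^ 2 ∂volI) / bLow := by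
  have he := hv.sub hU
  have hde := deriv_sub_ae hv.1 hU.1
  set e : ℝ → ℝ := fun x => v x - U x
  have e0 : e (-1) = 0 := by simp [e, v0, U0]
  have e1 : e 1 = 0 := by simp [e, v1, U1]
  have habs : ∀ᵐ x ∂volI, |b x| ≤ bUp := by
    filter_upwards [hbb] with x hx
    rw [abs_of_nonneg (hbLow.le.trans hx.1)]; exact hx.2
  have h1 := hu.2 e (he.memH10 e0 e1)
  have hw1 := weakDeriv_ae_eq hv huv
  have hw2 := weakDeriv_ae_eq he (Filter.EventuallyEq.refl _ e)
  have h2 : bilin ε b u e = ∫ x, (ε ^ 2 * deriv v x * deriv e x + b x * v x * e x) ∂volI := by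
    refine integral_congr_ae ?_
    filter_upwards [hw1, hw2, huv] with x h1 h2 h3
    rw [h1, h2, h3]
  have i1 {g : ℝ → ℝ} (hg : MemLp g 2 volI) :
      Integrable (fun x => ε ^ 2 * g x * deriv e x) volI := by
    simpa only [mul_assoc] using (integrable_mul_of_memLp_two hg he.2).const_mul (ε ^ 2)
  have i2 {g : ℝ → ℝ} (hg : MemLp g 2 volI) : Integrable (fun x => b x * g x * e x) volI :=
    integrable_mul_of_memLp_two (memLp_bounded_mul hb habs hg) he.memLp
  have i3 {g : ℝ → ℝ} (hg : MemLp g 2 volI) : Integrable (fun x => g x * e x) volI :=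
    integrable_mul_of_memLp_two hg he.memLp
  have h3 : ∫ x, (ε ^ 2 * deriv e x * deriv e x + b x * e x * e x) ∂volI =
      - ∫ x, (ε ^ 2 * P x * deriv e x + R x * e x) ∂volI := by
    rw [← hres e he e0 e1, eq_neg_iff_add_eq_zero, ← sub_eq_zero.2 h1, h2,
      ← integral_add ((i1 he.2).fun_add (i2 he.memLp))
        (((i1 hU.2).fun_add (i2 hU.memLp)).sub' (i3 hf)),
      ← integral_sub ((i1 hv.2).fun_add (i2 hv.memLp)) (i3 hf)]
    refine integral_congr_ae ?_
    filter_upwards [hde] with x hx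
    have : e x = v x - U x := rfl
    linear_combination (ε ^ 2 * deriv e x) * hx + b x * e x * this
  have sqe' := integrable_sq_of_memLp_two he.2
  have sqe := integrable_sq_of_memLp_two he.memLp
  have sqP := integrable_sq_of_memLp_two hP
  have sqR := integrable_sq_of_memLp_two hR
  -- Coercivity; the next inequality is Young's, with weights chosen to return exactly half of this
  -- left-hand side.
  have h4 : ∫ x, (ε ^ 2 * deriv e x ^ 2 + bLow * e x ^ 2) ∂volI ≤
      ∫ x, (ε ^ 2 * deriv e x * deriv e x + b x * e x * e x) ∂volI := by
    refine integral_mono_ae ((sqe'.const_mul _).add (sqe.const_mul _))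
      ((i1 he.2).add (i2 he.memLp)) ?_
    filter_upwards [hbb] with x hx
    nlinarith [mul_le_mul_of_nonneg_right hx.1 (sq_nonneg (e x))]
  have h5 : - ∫ x, (ε ^ 2 * P x * deriv e x + R x * e x) ∂volI ≤
      ∫ x, (ε ^ 2 / 2 * P x ^ 2 + 1 / (2 * bLow) * R x ^ 2
        + (ε ^ 2 / 2 * deriv e x ^ 2 + bLow / 2 * e x ^ 2)) ∂volI := by
    rw [← integral_neg]
    refine integral_mono ((i1 hP).add (i3 hR)).neg
      (((sqP.const_mul _).add (sqR.const_mul _)).add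
        ((sqe'.const_mul _).add (sqe.const_mul _))) fun x => ?_
    have k1 : 0 ≤ ε ^ 2 / 2 * (P x + deriv e x) ^ 2 := by positivity
    have k2 : 0 ≤ 1 / (2 * bLow) * (R x + bLow * e x) ^ 2 := by positivity
    have k3 : 1 / (2 * bLow) * (R x + bLow * e x) ^ 2 =
        1 / (2 * bLow) * R x ^ 2 + R x * e x + bLow / 2 * e x ^ 2 := by
      field_simp; ring
    dsimp only
    nlinarith
  rw [integral_add ((sqP.const_mul _).fun_add (sqR.const_mul _))
        ((sqe'.const_mul _).fun_add (sqe.const_mul _)),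
    integral_add (sqP.const_mul _) (sqR.const_mul _),
    integral_add (sqe'.const_mul _) (sqe.const_mul _)] at h5
  rw [integral_add (sqe'.const_mul _) (sqe.const_mul _)] at h4
  simp only [integral_const_mul] at h4 h5
  have h6 : ∫ x, (deriv v x - deriv U x) ^ 2 ∂volI = ∫ x, deriv e x ^ 2 ∂volI := by
    refine integral_congr_ae ?_
    filter_upwards [hde] with x hx
    rw [hx]
  rw [h6]
  have h7 : 1 / (2 * bLow) * ∫ x, R x ^ 2 ∂volI = (∫ x, R x ^ 2 ∂volI) / bLow / 2 := by
    field_simp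
  have h8 : ∫ x, e x ^ 2 ∂volI = ∫ x, (v x - U x) ^ 2 ∂volI := rfl
  rw [← h8]
  linarith

/-! ### Elementary estimates -/

/-- Cauchy–Schwarz, read off from the nonnegativity of the variance of `g` about its mean `m`. -/
theorem sq_integral_le {g : ℝ → ℝ} {x y : ℝ} (hxy : x ≤ y) (hg : IntervalIntegrable g volume x y)
    (hg2 : IntervalIntegrable (fun t => g t ^ 2) volume x y) :
    (∫ t in x..y, g t) ^ 2 ≤ (y - x) * ∫ t in x..y, g t ^ 2 := by
  rcases hxy.eq_or_lt with rfl | hlt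
  · simp
  set m := (∫ t in x..y, g t) / (y - x) with hm
  have h : 0 ≤ ∫ t in x..y, (g t - m) ^ 2 :=
    intervalIntegral.integral_nonneg hxy fun t _ => sq_nonneg _
  have e : ∀ t, (g t - m) ^ 2 = (g t ^ 2 - 2 * m * g t) + m ^ 2 := fun t => by ring
  simp only [e] at h
  rw [intervalIntegral.integral_add (hg2.sub (hg.const_mul _)) intervalIntegrable_const,
    intervalIntegral.integral_sub hg2 (hg.const_mul _), intervalIntegral.integral_const_mul,
    intervalIntegral.integral_const, smul_eq_mul] at h
  have hI : ∫ t in x..y, g t = m * (y - x) := by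
    rw [hm]; field_simp [sub_ne_zero.2 hlt.ne']
  rw [hI] at h ⊢
  nlinarith [sub_pos.2 hlt]

theorem intervalIntegrable_sub {g : ℝ → ℝ} (hg : Integrable g volI) {x y : ℝ}
    (hx : x ∈ Icc (-1 : ℝ) 1) (hy : y ∈ Icc (-1 : ℝ) 1) : IntervalIntegrable g volume x y :=
  (integrable_volI_iff.1 hg).mono_set (by rw [uIcc_I]; exact uIcc_subset_Icc hx hy)

theorem IsAC.sq_sub_le {v : ℝ → ℝ} (hv : IsAC v) {x y : ℝ} (hx : x ∈ Icc (-1 : ℝ) 1)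
    (hy : y ∈ Icc (-1 : ℝ) 1) (hxy : x ≤ y) :
    (v y - v x) ^ 2 ≤ (y - x) * ∫ t in x..y, deriv v t ^ 2 := by
  rw [← ac_sub_eq_integral hv.1 hx hy]
  exact sq_integral_le hxy (intervalIntegrable_sub (hv.2.integrable (by norm_num)) hx hy)
    (intervalIntegrable_sub (integrable_sq_of_memLp_two hv.2) hx hy)

theorem integral_subinterval_le {g : ℝ → ℝ} (hg : Integrable g volI) (h0 : ∀ t, 0 ≤ g t)
    {x y : ℝ} (hx : -1 ≤ x) (hy : y ≤ 1) (hxy : x ≤ y) :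
    ∫ t in x..y, g t ≤ ∫ t, g t ∂volI := by
  rw [integral_volI]
  exact intervalIntegral.integral_mono_interval hx hxy hy
    (Filter.Eventually.of_forall h0) (integrable_volI_iff.1 hg)

theorem IsAC.sq_sub_le_norm {v : ℝ → ℝ} (hv : IsAC v) {x y : ℝ} (hx : x ∈ Icc (-1 : ℝ) 1)
    (hy : y ∈ Icc (-1 : ℝ) 1) (hxy : x ≤ y) :
    (v y - v x) ^ 2 ≤ (y - x) * ∫ t, deriv v t ^ 2 ∂volI :=
  (hv.sq_sub_le hx hy hxy).trans <| mul_le_mul_of_nonneg_left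
    (integral_subinterval_le (integrable_sq_of_memLp_two hv.2) (fun _ => sq_nonneg _)
      hx.1 hy.2 hxy) (sub_nonneg.2 hxy)

theorem hasDerivAt_exp_affine (s c t : ℝ) :
    HasDerivAt (fun t => Real.exp (s * t + c)) (s * Real.exp (s * t + c)) t := by
  have : HasDerivAt (fun t => s * t + c) s t := by
    simpa using ((hasDerivAt_id t).const_mul s).add_const c
  simpa [mul_comm] using this.exp

theorem integral_exp_affine {s : ℝ} (hs : s ≠ 0) (c : ℝ) :
    ∫ t, Real.exp (s * t + c) ∂volI = (Real.exp (s + c) - Real.exp (-s + c)) / s := by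
  rw [integral_volI, intervalIntegral.integral_eq_sub_of_hasDerivAt
    (f := fun t => Real.exp (s * t + c) / s)]
  · simp [sub_div]
  · intro t _
    have := (hasDerivAt_exp_affine s c t).div_const s
    rwa [mul_div_cancel_left₀ _ hs] at this
  · exact (by fun_prop : Continuous fun t => Real.exp (s * t + c)).intervalIntegrable _ _

theorem integral_exp_layer_le {a s : ℝ} (ha : 0 < a) (hs : s = a ∨ s = -a) :
    ∫ t, Real.exp (s * t + -a) ∂volI ≤ 1 / a := by
  have hp := Real.exp_pos (-a + -a)
  rcases hs with rfl | rfl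
  · rw [integral_exp_affine ha.ne']
    gcongr
    simp only [add_neg_cancel, Real.exp_zero]
    linarith
  · rw [integral_exp_affine (neg_ne_zero.2 ha.ne'), div_neg, ← neg_div]
    gcongr
    simp only [neg_neg, add_neg_cancel, Real.exp_zero]
    linarith

theorem exp_affine_contDiff (s c : ℝ) (n : WithTop ℕ∞) :
    ContDiff ℝ n fun t => Real.exp (s * t + c) := by fun_prop

/-- Integration by parts of an exponential against a function vanishing at the end points. -/
theorem integral_deriv_exp_mul_deriv {e : ℝ → ℝ} (he : IsAC e) (e0 : e (-1) = 0) (e1 : e 1 = 0)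
    (s c : ℝ) : ∫ x, s * Real.exp (s * x + c) * deriv e x ∂volI =
      - ∫ x, s ^ 2 * Real.exp (s * x + c) * e x ∂volI := by
  have h := (ac_of_contDiff (contDiff_const.mul (exp_affine_contDiff s c 1) :
    ContDiff ℝ 1 fun x => s * Real.exp (s * x + c))).integral_mul_deriv_eq_deriv_mul he.1
  rw [integral_volI, integral_volI, h, e0, e1]
  have hd : ∀ x, deriv (fun x => s * Real.exp (s * x + c)) x = s ^ 2 * Real.exp (s * x + c) :=
    fun x => by rw [((hasDerivAt_exp_affine s c x).const_mul s).deriv]; ring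
  simp [hd]

/-! ### Asymptotic expansion of the solution -/

/-- The continuous functions `max B m` and `B` agree a.e., hence everywhere on the closed interval.
-/
theorem le_of_ae_le {B : ℝ → ℝ} {m : ℝ} (hB : ContinuousOn B (Icc (-1) 1))
    (h : ∀ᵐ x ∂volI, m ≤ B x) : ∀ x ∈ Icc (-1 : ℝ) 1, m ≤ B x := by
  intro x hx
  have := eqOn_Icc_of_ae_eq (ContinuousOn.sup hB (continuousOn_const (c := m))) hB (by
    filter_upwards [h] with x hx
    exact max_eq_left hx) hx
  simpa using this

/-- Inversion is Lipschitz with constant `1 / m²` on `[m, ∞)`, so `1 / B` inherits absolute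
continuity; the quotient rule, with `F` bounded, dominates the derivative by square integrable
functions. -/
theorem IsAC.div {F B : ℝ → ℝ} {m : ℝ} (hm : 0 < m) (hF : IsAC F) (hB : IsAC B)
    (h : ∀ x ∈ Icc (-1 : ℝ) 1, m ≤ B x) : IsAC fun x => F x / B x := by
  have hinv : AbsolutelyContinuousOnInterval (fun x => (B x)⁻¹) (-1) 1 := by
    refine ac_comp_of_dist_le (K := 1 / (m * m)) hB.1 fun x hx y hy => ?_
    have h1 := h x (uIcc_I ▸ hx)
    have h2 := h y (uIcc_I ▸ hy)
    rw [dist_inv_inv₀ (by linarith) (by linarith), div_eq_inv_mul, ← one_div]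
    simp only [Real.norm_eq_abs]
    rw [abs_of_pos (hm.trans_le h1), abs_of_pos (hm.trans_le h2)]
    have : 0 ≤ B x := hm.le.trans h1
    gcongr
  refine ⟨by simpa only [div_eq_mul_inv] using hF.1.fun_mul hinv, ?_⟩
  obtain ⟨C, hC⟩ := hF.1.exists_bound
  have hd : deriv (fun x => F x / B x) =ᵐ[volI]
      fun x => (deriv F x * B x - F x * deriv B x) / B x ^ 2 := by
    refine ae_volI_of_ae_mem ?_
    filter_upwards [hF.1.ae_differentiableAt, hB.1.ae_differentiableAt] with x h1 h2 hx
    have := h x hx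
    rw [← uIcc_I] at hx
    exact deriv_fun_div (h1 hx) (h2 hx) (by linarith)
  have hdom : MemLp (fun x => 1 / m * ‖deriv F x‖ + C / m ^ 2 * ‖deriv B x‖) 2 volI :=
    (hF.2.norm.const_mul _).add (hB.2.norm.const_mul _)
  refine hdom.mono' (measurable_deriv _).aestronglyMeasurable ?_
  filter_upwards [hd, ae_volI_of_forall fun x hx => (⟨hx, h x hx⟩ : _ ∧ _)] with x hx hxm
  have hBx : 0 < B x := hm.trans_le hxm.2
  have hCx : ‖F x‖ ≤ C := hC x (uIcc_I ▸ hxm.1)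
  have e : (deriv F x * B x - F x * deriv B x) / B x ^ 2 =
      1 / B x * deriv F x - F x / B x ^ 2 * deriv B x := by
    field_simp
  rw [hx, e]
  refine (norm_sub_le _ _).trans ?_
  rw [norm_mul, norm_mul, norm_div, norm_div, norm_pow, norm_one, Real.norm_of_nonneg hBx.le]
  have hC0 : 0 ≤ C := (norm_nonneg _).trans hCx
  gcongr
  · exact hxm.2
  · exact hxm.2

theorem exp_neg_le_one_div {x : ℝ} (hx : 0 < x) : Real.exp (-x) ≤ 1 / x := by
  rw [Real.exp_neg, ← one_div]
  exact one_div_le_one_div_of_le hx (by linarith [Real.add_one_le_exp x])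

/-- The sum of two exponential layers at `-1` and `1` and of an affine function. -/
def layers (α₁ α₂ a₁ a₂ p q t : ℝ) : ℝ :=
  α₁ * Real.exp (-a₁ * t + -a₁) + α₂ * Real.exp (a₂ * t + -a₂) + (p * t + q)

theorem layers_hasDerivAt (α₁ α₂ a₁ a₂ p q t : ℝ) :
    HasDerivAt (layers α₁ α₂ a₁ a₂ p q)
      (α₁ * (-a₁ * Real.exp (-a₁ * t + -a₁)) + α₂ * (a₂ * Real.exp (a₂ * t + -a₂)) + p) t := by
  have h3 : HasDerivAt (fun t => p * t + q) p t := by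
    simpa using ((hasDerivAt_id t).const_mul p).add_const q
  exact (((hasDerivAt_exp_affine (-a₁) (-a₁) t).const_mul α₁).add
    ((hasDerivAt_exp_affine a₂ (-a₂) t).const_mul α₂)).add h3

theorem layers_contDiff (α₁ α₂ a₁ a₂ p q : ℝ) : ContDiff ℝ 1 (layers α₁ α₂ a₁ a₂ p q) := by
  unfold layers; fun_prop

theorem memLp_layers_residual {B : ℝ → ℝ} (hB : IsAC B) (α₁ α₂ a₁ a₂ p q : ℝ) :
    MemLp (fun x => B x * layers α₁ α₂ a₁ a₂ p q x
      - B (-1) * α₁ * Real.exp (-a₁ * x + -a₁) - B 1 * α₂ * Real.exp (a₂ * x + -a₂)) 2 volI := by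
  obtain ⟨C, hC⟩ := hB.1.exists_bound
  rw [uIcc_I] at hC
  refine MemLp.sub (MemLp.sub ?_ (memLp_of_continuous (by fun_prop)))
    (memLp_of_continuous (by fun_prop))
  exact memLp_bounded_mul (ac_integrable hB.1).aestronglyMeasurable (ae_volI_of_forall hC)
    (memLp_of_continuous (layers_contDiff _ _ _ _ _ _).continuous)

/-- Each exponential solves the equation with the coefficient frozen at its end point, so
integrating it by parts replaces its diffusion term by `B(±1)` times itself. The derivatives of `G`
and of the affine part stay in the flux. -/
theorem layers_residual {ε : ℝ} {b f B F G : ℝ → ℝ} {α₁ α₂ a₁ a₂ p q : ℝ}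
    (hB : IsAC B) (hG : IsAC G) (hbB : b =ᵐ[volI] B) (hfF : f =ᵐ[volI] F)
    (hBG : ∀ x ∈ Icc (-1 : ℝ) 1, B x * G x = F x)
    (h1 : ε ^ 2 * a₁ ^ 2 = B (-1)) (h2 : ε ^ 2 * a₂ ^ 2 = B 1)
    {e : ℝ → ℝ} (he : IsAC e) (e0 : e (-1) = 0) (e1 : e 1 = 0) :
    ∫ x, (ε ^ 2 * deriv (fun x => G x + layers α₁ α₂ a₁ a₂ p q x) x * deriv e x
        + b x * (G x + layers α₁ α₂ a₁ a₂ p q x) * e x - f x * e x) ∂volI =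
      ∫ x, (ε ^ 2 * (deriv G x + p) * deriv e x + (B x * layers α₁ α₂ a₁ a₂ p q x
        - B (-1) * α₁ * Real.exp (-a₁ * x + -a₁) - B 1 * α₂ * Real.exp (a₂ * x + -a₂))
          * e x) ∂volI := by
  have hW := layers_contDiff α₁ α₂ a₁ a₂ p q
  obtain ⟨C, hC⟩ := hB.1.exists_bound
  rw [uIcc_I] at hC
  have k1 := integral_deriv_exp_mul_deriv he e0 e1 (-a₁) (-a₁)
  have k2 := integral_deriv_exp_mul_deriv he e0 e1 a₂ (-a₂)
  have ie {s c : ℝ} : Integrable (fun x => s ^ 2 * Real.exp (s * x + c) * e x) volI :=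
    integrable_mul_of_memLp_two (memLp_of_continuous (by fun_prop)) he.memLp
  have ie' {s c : ℝ} : Integrable (fun x => s * Real.exp (s * x + c) * deriv e x) volI :=
    integrable_mul_of_memLp_two (memLp_of_continuous (by fun_prop)) he.2
  have iP : Integrable (fun x => ε ^ 2 * (deriv G x + p) * deriv e x) volI :=
    integrable_mul_of_memLp_two ((hG.2.add (memLp_const p)).const_mul (ε ^ 2)) he.2
  have iR : Integrable (fun x => (B x * layers α₁ α₂ a₁ a₂ p q x
        - B (-1) * α₁ * Real.exp (-a₁ * x + -a₁) - B 1 * α₂ * Real.exp (a₂ * x + -a₂))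
          * e x) volI :=
    integrable_mul_of_memLp_two (memLp_layers_residual hB α₁ α₂ a₁ a₂ p q) he.memLp
  have key : ∫ x, (ε ^ 2 * deriv (fun x => G x + layers α₁ α₂ a₁ a₂ p q x) x * deriv e x
        + b x * (G x + layers α₁ α₂ a₁ a₂ p q x) * e x - f x * e x) ∂volI =
      ∫ x, ((ε ^ 2 * (deriv G x + p) * deriv e x + (B x * layers α₁ α₂ a₁ a₂ p q x
        - B (-1) * α₁ * Real.exp (-a₁ * x + -a₁) - B 1 * α₂ * Real.exp (a₂ * x + -a₂))
          * e x) + (ε ^ 2 * α₁ * (-a₁ * Real.exp (-a₁ * x + -a₁) * deriv e x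
            + (-a₁) ^ 2 * Real.exp (-a₁ * x + -a₁) * e x)
          + ε ^ 2 * α₂ * (a₂ * Real.exp (a₂ * x + -a₂) * deriv e x
            + a₂ ^ 2 * Real.exp (a₂ * x + -a₂) * e x))) ∂volI := by
    refine integral_congr_ae ?_
    filter_upwards [hbB, hfF, deriv_add_ae hG.1 (ac_of_contDiff hW), ae_volI_of_forall hBG]
      with x x1 x2 x3 x4
    rw [x1, x2, x3, ← x4, (layers_hasDerivAt α₁ α₂ a₁ a₂ p q x).deriv, ← h1, ← h2]
    ring
  rw [key, integral_add (iP.fun_add iR)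
    (((ie'.fun_add ie).const_mul _).fun_add ((ie'.fun_add ie).const_mul _)),
    integral_add ((ie'.fun_add ie).const_mul _) ((ie'.fun_add ie).const_mul _),
    integral_const_mul, integral_const_mul, integral_add ie' ie, integral_add ie' ie, k1, k2]
  ring

/-- Squaring yields two exponential factors. One is spent on `d * exp (-(a * d)) ≤ 1 / a`; the other
is kept, since its integral supplies a second factor `1 / a`. -/
theorem sq_mul_exp_le {a d D y s : ℝ} (ha : 0 < a) (hd : 0 ≤ d) (hD : 0 ≤ D)
    (hy : y ^ 2 ≤ d * D) (hs : s = -(a * d)) : (y * Real.exp s) ^ 2 ≤ D / a * Real.exp s := by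
  have h1 : d * Real.exp s ≤ 1 / a := by
    rcases hd.eq_or_lt with rfl | hd
    · simp [ha.le]
    · rw [hs]
      have := exp_neg_le_one_div (mul_pos ha hd)
      calc d * Real.exp (-(a * d)) ≤ d * (1 / (a * d)) := by gcongr
        _ = 1 / a := by field_simp
  calc (y * Real.exp s) ^ 2 = y ^ 2 * Real.exp s * Real.exp s := by ring
    _ ≤ (d * D) * Real.exp s * Real.exp s := by gcongr
    _ = D * (d * Real.exp s) * Real.exp s := by ring
    _ ≤ D * (1 / a) * Real.exp s := by gcongr
    _ = D / a * Real.exp s := by ring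

theorem integral_volI_const (c : ℝ) : ∫ _, c ∂volI = 2 * c := by
  rw [integral_volI (fun _ => c), intervalIntegral.integral_const, smul_eq_mul]
  ring

theorem integrable_exp_affine (s c : ℝ) : Integrable (fun x => Real.exp (s * x + c)) volI :=
  (memLp_of_continuous (by fun_prop)).integrable (by norm_num)

/-- The residual regroups into `B x - B (±1)` times the matching exponential, controlled by Hölder
continuity and `sq_mul_exp_le`, and `B` times the small affine part. -/
theorem layers_residual_sq_le_pointwise {B : ℝ → ℝ} (hB : IsAC B) {C : ℝ}
    (hC : ∀ x ∈ Icc (-1 : ℝ) 1, |B x| ≤ C) {α₁ α₂ a₁ a₂ p q δ : ℝ} (pa₁ : 0 < a₁) (pa₂ : 0 < a₂)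
    (bp : |p| ≤ δ) (bq : |q| ≤ δ) {x : ℝ} (hx : x ∈ Icc (-1 : ℝ) 1) :
    (B x * layers α₁ α₂ a₁ a₂ p q x - B (-1) * α₁ * Real.exp (-a₁ * x + -a₁)
        - B 1 * α₂ * Real.exp (a₂ * x + -a₂)) ^ 2 ≤
      3 * α₁ ^ 2 * ((∫ x, deriv B x ^ 2 ∂volI) / a₁) * Real.exp (-a₁ * x + -a₁)
        + 3 * α₂ ^ 2 * ((∫ x, deriv B x ^ 2 ∂volI) / a₂) * Real.exp (a₂ * x + -a₂)
        + 3 * (C * (2 * δ)) ^ 2 := by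
  have hC0 : 0 ≤ C := (abs_nonneg _).trans (hC 0 (by simp))
  have D0 : 0 ≤ ∫ x, deriv B x ^ 2 ∂volI := integral_nonneg fun _ => sq_nonneg _
  have y1 := sq_mul_exp_le (s := -a₁ * x + -a₁) pa₁ (by linarith [hx.1]) D0
    (hB.sq_sub_le_norm (x := -1) (by simp) hx hx.1) (by ring)
  have y2 := sq_mul_exp_le (s := a₂ * x + -a₂) pa₂ (by linarith [hx.2]) D0
    (hB.sq_sub_le_norm (y := 1) hx (by simp) hx.2) (by ring)
  have y3 : (B x * (p * x + q)) ^ 2 ≤ (C * (2 * δ)) ^ 2 := by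
    refine sq_le_sq.2 (le_trans ?_ (le_abs_self _))
    rw [abs_mul]
    have : |p * x + q| ≤ 2 * δ := by
      refine (abs_add_le _ _).trans ?_
      rw [abs_mul]
      have : |x| ≤ 1 := abs_le.2 hx
      nlinarith [abs_nonneg p, abs_nonneg x]
    exact mul_le_mul (hC x hx) this (abs_nonneg _) hC0
  have hRx : B x * layers α₁ α₂ a₁ a₂ p q x - B (-1) * α₁ * Real.exp (-a₁ * x + -a₁)
      - B 1 * α₂ * Real.exp (a₂ * x + -a₂) = α₁ * ((B x - B (-1)) * Real.exp (-a₁ * x + -a₁))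
      + -α₂ * ((B 1 - B x) * Real.exp (a₂ * x + -a₂)) + B x * (p * x + q) := by
    rw [layers]; ring
  have three (r s t : ℝ) : (r + s + t) ^ 2 ≤ 3 * r ^ 2 + 3 * s ^ 2 + 3 * t ^ 2 := by
    nlinarith [sq_nonneg (r - s), sq_nonneg (s - t), sq_nonneg (r - t)]
  rw [hRx]
  refine (three _ _ _).trans ?_
  rw [mul_pow α₁, mul_pow (-α₂), neg_sq]
  have z1 := mul_le_mul_of_nonneg_left y1 (sq_nonneg α₁)
  have z2 := mul_le_mul_of_nonneg_left y2 (sq_nonneg α₂)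
  linarith

theorem layers_residual_sq_le {B : ℝ → ℝ} (hB : IsAC B) {C : ℝ}
    (hC : ∀ x ∈ Icc (-1 : ℝ) 1, |B x| ≤ C) {α₁ α₂ a₁ a₂ p q δ : ℝ} (pa₁ : 0 < a₁) (pa₂ : 0 < a₂)
    (bp : |p| ≤ δ) (bq : |q| ≤ δ) :
    ∫ x, (B x * layers α₁ α₂ a₁ a₂ p q x - B (-1) * α₁ * Real.exp (-a₁ * x + -a₁)
        - B 1 * α₂ * Real.exp (a₂ * x + -a₂)) ^ 2 ∂volI ≤
      3 * α₁ ^ 2 * (∫ x, deriv B x ^ 2 ∂volI) * (1 / a₁) ^ 2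
        + 3 * α₂ ^ 2 * (∫ x, deriv B x ^ 2 ∂volI) * (1 / a₂) ^ 2 + 6 * (C * (2 * δ)) ^ 2 := by
  have D0 : 0 ≤ ∫ x, deriv B x ^ 2 ∂volI := integral_nonneg fun _ => sq_nonneg _
  have i1 := integrable_exp_affine (-a₁) (-a₁)
  have i2 := integrable_exp_affine a₂ (-a₂)
  refine (integral_mono_ae (integrable_sq_of_memLp_two (memLp_layers_residual hB _ _ _ _ _ _))
    (((i1.const_mul _).fun_add (i2.const_mul _)).fun_add (integrable_const _))
    (ae_volI_of_forall fun x hx =>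
      layers_residual_sq_le_pointwise hB hC pa₁ pa₂ bp bq hx)).trans ?_
  rw [integral_add ((i1.const_mul _).fun_add (i2.const_mul _)) (integrable_const _),
    integral_add (i1.const_mul _) (i2.const_mul _), integral_const_mul, integral_const_mul,
    integral_volI_const]
  set D := ∫ x, deriv B x ^ 2 ∂volI
  calc _ ≤ 3 * α₁ ^ 2 * (D / a₁) * (1 / a₁) + 3 * α₂ ^ 2 * (D / a₂) * (1 / a₂)
            + 2 * (3 * (C * (2 * δ)) ^ 2) := by
          gcongr
          · exact integral_exp_layer_le pa₁ (Or.inr rfl)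
          · exact integral_exp_layer_le pa₂ (Or.inl rfl)
    _ = _ := by ring

theorem integral_add_const_sq_le {g : ℝ → ℝ} (hg : MemLp g 2 volI) (p : ℝ) :
    ∫ x, (g x + p) ^ 2 ∂volI ≤ 2 * ∫ x, g x ^ 2 ∂volI + 4 * p ^ 2 := by
  have i1 := (integrable_sq_of_memLp_two hg).const_mul 2
  calc ∫ x, (g x + p) ^ 2 ∂volI ≤ ∫ x, (2 * g x ^ 2 + 2 * p ^ 2) ∂volI := by
        refine integral_mono (integrable_sq_of_memLp_two (hg.add (memLp_const p)))
          (i1.add (integrable_const _)) fun x => ?_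
        dsimp only; nlinarith [sq_nonneg (g x - p)]
    _ = 2 * ∫ x, g x ^ 2 ∂volI + 4 * p ^ 2 := by
        rw [integral_add i1 (integrable_const _), integral_const_mul, integral_volI_const]
        ring

/-- The solution differs from the sum of the reduced solution `F / B` and of two exponential layers
by `O(ε)` in the energy norm. -/
theorem asymptotic_expansion {bLow bUp : ℝ} {b f B F : ℝ → ℝ} (hbLow : 0 < bLow)
    (hbb : ∀ᵐ x ∂volI, bLow ≤ b x ∧ b x ≤ bUp) (hB : IsAC B) (hF : IsAC F)
    (hbB : b =ᵐ[volI] B) (hfF : f =ᵐ[volI] F) (hBm : ∀ x ∈ Icc (-1 : ℝ) 1, bLow ≤ B x) :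
    ∃ K > (0 : ℝ), ∀ ε : ℝ, 0 < ε → ε ≤ 1 → ∀ u v : ℝ → ℝ, IsWeakSolution ε b f u → IsAC v →
      u =ᵐ[volI] v → v (-1) = 0 → v 1 = 0 → ∃ p q : ℝ, ∀ W : ℝ → ℝ,
      W = layers (-(F (-1) / B (-1))) (-(F 1 / B 1)) (√(B (-1)) / ε) (√(B 1) / ε) p q →
        F (-1) / B (-1) + W (-1) = 0 ∧ F 1 / B 1 + W 1 = 0 ∧
        ε ^ 2 * ∫ x, (deriv v x - deriv (fun x => F x / B x + W x) x) ^ 2 ∂volI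
          + ∫ x, (v x - (F x / B x + W x)) ^ 2 ∂volI ≤ K * ε ^ 2 := by
  have hG := hF.div hbLow hB hBm
  set G : ℝ → ℝ := fun x => F x / B x
  set α₁ := -G (-1) with hα₁
  set α₂ := -G 1 with hα₂
  obtain ⟨C, hC⟩ := hB.1.exists_bound
  rw [uIcc_I] at hC
  have hC0 : 0 ≤ C := (norm_nonneg _).trans (hC 0 (by simp))
  set D := ∫ x, deriv B x ^ 2 ∂volI with hD
  have D0 : 0 ≤ D := integral_nonneg fun _ => sq_nonneg _
  set DG := ∫ x, deriv G x ^ 2 ∂volI with hDG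
  have DG0 : 0 ≤ DG := integral_nonneg fun _ => sq_nonneg _
  set S := (|α₁| + |α₂|) / √bLow with hS
  have sb : 0 < √bLow := Real.sqrt_pos.2 hbLow
  have S0 : 0 ≤ S := by positivity
  -- The two summands bound, after division by `ε²`, the flux and the `L²` contributions of the
  -- residual; `S * ε` will bound `|p|` and `|q|`.
  set K₀ := (2 * DG + 4 * S ^ 2) +
    3 * (α₁ ^ 2 * D / bLow + α₂ ^ 2 * D / bLow + 2 * (C * (2 * S)) ^ 2) / bLow with hK₀
  have K₀0 : 0 ≤ K₀ := by positivity
  -- The factor `1 + 1 / bLow` trades the weight `bLow` of the `L²` term for `1`; the `+ 1` only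
  -- ensures positivity.
  refine ⟨(1 + 1 / bLow) * (K₀ + 1), by positivity, fun ε hε hε1 u v hu hv huv v0 v1 => ?_⟩
  set a₁ := √(B (-1)) / ε with ha₁
  set a₂ := √(B 1) / ε with ha₂
  have B1 := hBm (-1) (by simp)
  have B2 := hBm 1 (by simp)
  have pa₁ : 0 < a₁ := div_pos (Real.sqrt_pos.2 (hbLow.trans_le B1)) hε
  have pa₂ : 0 < a₂ := div_pos (Real.sqrt_pos.2 (hbLow.trans_le B2)) hε
  have sq₁ : ε ^ 2 * a₁ ^ 2 = B (-1) := by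
    rw [ha₁, div_pow, Real.sq_sqrt (hbLow.le.trans B1)]; field_simp
  have sq₂ : ε ^ 2 * a₂ ^ 2 = B 1 := by
    rw [ha₂, div_pow, Real.sq_sqrt (hbLow.le.trans B2)]; field_simp
  have inv₁ : 1 / a₁ ≤ ε / √bLow := by
    rw [ha₁, one_div_div]; gcongr
  have inv₂ : 1 / a₂ ≤ ε / √bLow := by
    rw [ha₂, one_div_div]; gcongr
  set E₁ := Real.exp (-(2 * a₁)) with hE₁
  set E₂ := Real.exp (-(2 * a₂)) with hE₂
  have bE₁ : α₁ * E₁ ∈ Icc (-(|α₁| * (ε / √bLow))) (|α₁| * (ε / √bLow)) := by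
    rw [mem_Icc, ← abs_le, abs_mul, hE₁, Real.abs_exp]
    gcongr
    refine (exp_neg_le_one_div (by positivity)).trans (le_trans ?_ inv₁)
    gcongr; linarith
  have bE₂ : α₂ * E₂ ∈ Icc (-(|α₂| * (ε / √bLow))) (|α₂| * (ε / √bLow)) := by
    rw [mem_Icc, ← abs_le, abs_mul, hE₂, Real.abs_exp]
    gcongr
    refine (exp_neg_le_one_div (by positivity)).trans (le_trans ?_ inv₂)
    gcongr; linarith
  have hSε : S * ε = |α₁| * (ε / √bLow) + |α₂| * (ε / √bLow) := by rw [hS]; ring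
  -- The affine function takes the values `-α₂ E₂` at `-1` and `-α₁ E₁` at `1`, cancelling what each
  -- exponential leaves at the opposite end point.
  set p := (α₂ * E₂ - α₁ * E₁) / 2 with hp
  set q := -(α₁ * E₁ + α₂ * E₂) / 2 with hq
  have bp : |p| ≤ S * ε := by
    rw [hSε, abs_le, hp]; constructor <;> linarith [bE₁.1, bE₁.2, bE₂.1, bE₂.2]
  have bq : |q| ≤ S * ε := by
    rw [hSε, abs_le, hq]; constructor <;> linarith [bE₁.1, bE₁.2, bE₂.1, bE₂.2]
  refine ⟨p, q, fun W hW => ?_⟩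
  have W0 : G (-1) + W (-1) = 0 := by
    have x1 : -a₁ * -1 + -a₁ = 0 := by ring
    have x2 : a₂ * -1 + -a₂ = -(2 * a₂) := by ring
    rw [hW, layers, x1, x2, Real.exp_zero, ← hE₂, hp, hq, hα₁]
    ring
  have W1 : G 1 + W 1 = 0 := by
    have x1 : -a₁ * 1 + -a₁ = -(2 * a₁) := by ring
    have x2 : a₂ * 1 + -a₂ = 0 := by ring
    rw [hW, layers, x1, x2, Real.exp_zero, ← hE₁, hp, hq, hα₂]
    ring
  refine ⟨W0, W1, ?_⟩
  clear_value p q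
  have hWc : ContDiff ℝ 1 W := hW ▸ layers_contDiff _ _ _ _ _ _
  have hU : IsAC fun x => G x + W x := hG.add (isAC_of_contDiff hWc)
  have hBG : ∀ x ∈ Icc (-1 : ℝ) 1, B x * G x = F x := fun x hx =>
    mul_div_cancel₀ _ (by linarith [hBm x hx])
  set R : ℝ → ℝ := fun x => B x * W x
        - B (-1) * α₁ * Real.exp (-a₁ * x + -a₁) - B 1 * α₂ * Real.exp (a₂ * x + -a₂) with hR
  have memR : MemLp R 2 volI := by
    have := memLp_layers_residual hB α₁ α₂ a₁ a₂ p q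
    rwa [← hW] at this
  have memP : MemLp (fun x => deriv G x + p) 2 volI := hG.2.add (memLp_const p)
  have bm : AEStronglyMeasurable b volI :=
    (ac_integrable hB.1).aestronglyMeasurable.congr hbB.symm
  have fm : MemLp f 2 volI := (memLp_congr_ae hfF).2 hF.memLp
  have en := energy_estimate (U := fun x => G x + W x) hbLow bm hbb fm hu hv huv v0 v1 hU W0 W1
    memP memR fun e he e0 e1 => by
      have := layers_residual (α₁ := α₁) (α₂ := α₂) (p := p) (q := q) hB hG hbB hfF hBG
        sq₁ sq₂ he e0 e1
      rw [← hW] at this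
      exact this
  have eP : ∫ x, (deriv G x + p) ^ 2 ∂volI ≤ 2 * DG + 4 * (S * ε) ^ 2 := by
    refine (integral_add_const_sq_le hG.2 p).trans ?_
    have := sq_le_sq' (abs_le.1 bp).1 (abs_le.1 bp).2
    linarith
  have eR : ∫ x, R x ^ 2 ∂volI ≤
      3 * (α₁ ^ 2 * D / bLow + α₂ ^ 2 * D / bLow + 2 * (C * (2 * S)) ^ 2) * ε ^ 2 := by
    calc ∫ x, R x ^ 2 ∂volI ≤ 3 * α₁ ^ 2 * D * (1 / a₁) ^ 2 + 3 * α₂ ^ 2 * D * (1 / a₂) ^ 2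
            + 6 * (C * (2 * (S * ε))) ^ 2 := by
          have := layers_residual_sq_le (α₁ := α₁) (α₂ := α₂) hB hC pa₁ pa₂ bp bq
          rwa [← hW] at this
      _ ≤ 3 * α₁ ^ 2 * D * (ε / √bLow) ^ 2 + 3 * α₂ ^ 2 * D * (ε / √bLow) ^ 2
            + 6 * (C * (2 * (S * ε))) ^ 2 := by gcongr
      _ = _ := by
          rw [div_pow, Real.sq_sqrt hbLow.le]; ring
  set X := ∫ x, (deriv v x - deriv (fun x => G x + W x) x) ^ 2 ∂volI with hX
  set Y := ∫ x, (v x - (G x + W x)) ^ 2 ∂volI with hY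
  have X0 : 0 ≤ X := integral_nonneg fun _ => sq_nonneg _
  have Y0 : 0 ≤ Y := integral_nonneg fun _ => sq_nonneg _
  have tot : ε ^ 2 * X + bLow * Y ≤ K₀ * ε ^ 2 := by
    refine en.trans ?_
    have z0 : ε ^ 2 * (2 * DG + 4 * (S * ε) ^ 2) ≤ ε ^ 2 * (2 * DG + 4 * S ^ 2) := by
      have : S * ε ≤ S := mul_le_of_le_one_right S0 hε1
      gcongr
    have z1 := (mul_le_mul_of_nonneg_left eP (sq_nonneg ε)).trans z0
    have z2 := div_le_div_of_nonneg_right eR hbLow.le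
    refine (add_le_add z1 z2).trans (le_of_eq ?_)
    rw [hK₀]; ring
  have : ε ^ 2 * X + Y ≤ (1 + 1 / bLow) * (ε ^ 2 * X + bLow * Y) := by
    have : (1 + 1 / bLow) * (ε ^ 2 * X + bLow * Y) =
      ε ^ 2 * X + Y + (1 / bLow * (ε ^ 2 * X) + bLow * Y) := by field_simp; ring
    rw [this]
    have : 0 ≤ 1 / bLow * (ε ^ 2 * X) + bLow * Y := by positivity
    linarith
  refine this.trans ?_
  calc (1 + 1 / bLow) * (ε ^ 2 * X + bLow * Y) ≤ (1 + 1 / bLow) * (K₀ * ε ^ 2) := by gcongr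
    _ ≤ (1 + 1 / bLow) * (K₀ + 1) * ε ^ 2 := by
      rw [mul_assoc]; gcongr; linarith

/-! ### Continuous piecewise affine interpolation by sums of ReLU functions -/

theorem IsAC.const_mul {v : ℝ → ℝ} (hv : IsAC v) (c : ℝ) : IsAC fun x => c * v x := by
  refine ⟨hv.1.const_mul c, ?_⟩
  have : deriv (fun x => c * v x) = fun x => c * deriv v x := funext fun x => deriv_const_mul_field c
  rw [this]
  exact hv.2.const_mul c

theorem isAC_sum {ι : Type*} (s : Finset ι) {v : ι → ℝ → ℝ} (h : ∀ i ∈ s, IsAC (v i)) :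
    IsAC fun t => ∑ i ∈ s, v i t := by
  classical
  induction s using Finset.induction_on with
  | empty => simpa using isAC_of_contDiff (v := fun _ => 0) contDiff_const
  | insert i s hi ih =>
    simp only [Finset.sum_insert hi]
    exact (h i (by simp)).add (ih fun j hj => h j (by simp [hj]))

theorem relu_sub_lipschitz (a : ℝ) : LipschitzWith 1 fun t => relu (t - a) := by
  refine LipschitzWith.of_dist_le_mul fun x y => ?_
  have := abs_max_sub_max_le_abs (x - a) (y - a) 0
  rw [max_comm, max_comm (y - a)] at this
  simpa [relu, Real.dist_eq] using this

theorem isAC_relu_sub (a : ℝ) : IsAC fun t => relu (t - a) := by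
  refine ⟨((relu_sub_lipschitz a).lipschitzOnWith).absolutelyContinuousOnInterval,
    MemLp.of_bound (measurable_deriv _).aestronglyMeasurable 1
      (Filter.Eventually.of_forall fun t => ?_)⟩
  simpa using norm_deriv_le_of_lipschitz (x₀ := t) (relu_sub_lipschitz a)

/-- The continuous piecewise affine function with kinks `x i` and slope changes `c i`. -/
def reluSum (M : ℕ) (x c : ℕ → ℝ) (t : ℝ) : ℝ := ∑ i ∈ Finset.range M, c i * relu (t - x i)

theorem isAC_reluSum (M : ℕ) (x c : ℕ → ℝ) : IsAC (reluSum M x c) :=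
  isAC_sum _ fun i _ => (isAC_relu_sub (x i)).const_mul (c i)

/-- The slope changes belonging to a sequence of slopes. -/
def slopeChange (s : ℕ → ℝ) : ℕ → ℝ
  | 0 => s 0
  | i + 1 => s (i + 1) - s i

theorem sum_slopeChange (s : ℕ → ℝ) (j : ℕ) :
    ∑ i ∈ Finset.range (j + 1), slopeChange s i = s j := by
  induction j with
  | zero => simp [slopeChange]
  | succ j ih => rw [Finset.sum_range_succ, ih, slopeChange]; ring

/-- The slope of the affine interpolant of `U` between `x j` and `x (j + 1)`. -/
def cellSlope (U : ℝ → ℝ) (x : ℕ → ℝ) (j : ℕ) : ℝ :=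
  (U (x (j + 1)) - U (x j)) / (x (j + 1) - x j)

theorem mesh_monotone {M : ℕ} {x : ℕ → ℝ} (hx : ∀ j < M, x j < x (j + 1)) {i j : ℕ}
    (hij : i ≤ j) (hj : j ≤ M) : x i ≤ x j := by
  induction j, hij using Nat.le_induction with
  | base => exact le_rfl
  | succ j hij ih => exact (ih (by omega)).trans (hx j (by omega)).le

theorem reluSum_eq_on_cell {M : ℕ} {x c : ℕ → ℝ} (hx : ∀ j < M, x j < x (j + 1)) {j : ℕ}
    (hj : j < M) {t : ℝ} (ht : t ∈ Icc (x j) (x (j + 1))) :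
    reluSum M x c t = ∑ i ∈ Finset.range (j + 1), c i * (t - x i) := by
  rw [reluSum, ← Finset.sum_range_add_sum_Ico _ (show j + 1 ≤ M from hj)]
  rw [Finset.sum_eq_zero (s := Finset.Ico (j + 1) M), add_zero]
  · refine Finset.sum_congr rfl fun i hi => ?_
    have hi' : i ≤ j := Nat.lt_succ_iff.1 (Finset.mem_range.1 hi)
    rw [relu, max_eq_right]
    linarith [mesh_monotone hx hi' hj.le, ht.1]
  · intro i hi
    rw [Finset.mem_Ico] at hi
    rw [relu, max_eq_left, mul_zero]
    linarith [mesh_monotone hx hi.1 hi.2.le, ht.2]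

/-- Exactly the ReLUs with index at most `j` are active on this cell, and their slope changes
telescope to `s j`. -/
theorem reluSum_eq_affine {M : ℕ} {x s : ℕ → ℝ} (hx : ∀ j < M, x j < x (j + 1)) {j : ℕ}
    (hj : j < M) {t : ℝ} (ht : t ∈ Icc (x j) (x (j + 1))) :
    reluSum M x (slopeChange s) t = reluSum M x (slopeChange s) (x j) + s j * (t - x j) := by
  rw [reluSum_eq_on_cell hx hj ht, reluSum_eq_on_cell hx hj (left_mem_Icc.2 (hx j hj).le),
    ← sum_slopeChange s j, Finset.sum_mul, ← Finset.sum_add_distrib]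
  exact Finset.sum_congr rfl fun i _ => by ring

theorem reluSum_node {M : ℕ} {x : ℕ → ℝ} (hx : ∀ j < M, x j < x (j + 1)) {U : ℝ → ℝ}
    (hU : U (x 0) = 0) {j : ℕ} (hj : j ≤ M) :
    reluSum M x (slopeChange (cellSlope U x)) (x j) = U (x j) := by
  induction j with
  | zero =>
    rw [hU]
    refine Finset.sum_eq_zero fun i hi => ?_
    rw [relu, max_eq_left, mul_zero]
    linarith [mesh_monotone hx (Nat.zero_le i) (Finset.mem_range.1 hi).le]
  | succ j ih =>
    have hlt := hx j hj
    rw [reluSum_eq_affine hx hj (right_mem_Icc.2 hlt.le), ih (by omega), cellSlope,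
      div_mul_cancel₀ _ (sub_ne_zero.2 hlt.ne')]
    ring

theorem reluSum_interp {M : ℕ} {x : ℕ → ℝ} (hx : ∀ j < M, x j < x (j + 1)) {U : ℝ → ℝ}
    (hU : U (x 0) = 0) {j : ℕ} (hj : j < M) {t : ℝ} (ht : t ∈ Icc (x j) (x (j + 1))) :
    reluSum M x (slopeChange (cellSlope U x)) t = U (x j) + cellSlope U x j * (t - x j) := by
  rw [reluSum_eq_affine hx hj ht, reluSum_node hx hU hj.le]

theorem deriv_reluSum_interp {M : ℕ} {x : ℕ → ℝ} (hx : ∀ j < M, x j < x (j + 1)) {U : ℝ → ℝ}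
    (hU : U (x 0) = 0) {j : ℕ} (hj : j < M) {t : ℝ} (ht : t ∈ Ioo (x j) (x (j + 1))) :
    deriv (reluSum M x (slopeChange (cellSlope U x))) t = cellSlope U x j := by
  have : reluSum M x (slopeChange (cellSlope U x)) =ᶠ[nhds t]
      fun t => U (x j) + cellSlope U x j * (t - x j) := by
    filter_upwards [isOpen_Ioo.mem_nhds ht] with r hr
    exact reluSum_interp hx hU hj (Ioo_subset_Icc_self hr)
  rw [this.deriv_eq]
  have h : HasDerivAt (fun t => U (x j) + cellSlope U x j * (t - x j)) (cellSlope U x j) t := by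
    simpa using (((hasDerivAt_id t).sub_const (x j)).const_mul (cellSlope U x j)).const_add (U (x j))
  exact h.deriv

/-- Summation of local bounds over the mesh; the factor 2 is the length of the interval. -/
theorem integral_le_of_cells {M : ℕ} {x : ℕ → ℝ} (h0 : x 0 = -1) (hM : x M = 1)
    (hx : ∀ j < M, x j < x (j + 1)) {g D : ℝ → ℝ} (hg : Integrable g volI)
    (hD : Integrable D volI) {A C : ℝ}
    (h : ∀ j < M, ∫ t in x j..x (j + 1), g t ≤
      A * (∫ t in x j..x (j + 1), D t) + C * (x (j + 1) - x j)) :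
    ∫ t, g t ∂volI ≤ A * ∫ t, D t ∂volI + 2 * C := by
  have mem : ∀ j ≤ M, x j ∈ Icc (-1 : ℝ) 1 := fun j hj =>
    ⟨h0 ▸ mesh_monotone hx (Nat.zero_le j) hj, hM ▸ mesh_monotone hx hj le_rfl⟩
  have hsum : ∀ f : ℝ → ℝ, Integrable f volI →
      ∑ j ∈ Finset.range M, ∫ t in x j..x (j + 1), f t = ∫ t, f t ∂volI := fun f hf => by
    rw [intervalIntegral.sum_integral_adjacent_intervals fun j hj =>
      intervalIntegrable_sub hf (mem j hj.le) (mem (j + 1) hj), h0, hM, integral_volI]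
  rw [← hsum g hg, ← hsum D hD]
  have h2 : (2 : ℝ) = ∑ j ∈ Finset.range M, (x (j + 1) - x j) := by
    rw [Finset.sum_range_sub, h0, hM]; norm_num
  rw [h2, Finset.sum_mul, Finset.mul_sum, ← Finset.sum_add_distrib]
  exact Finset.sum_le_sum fun j hj => by
    have := h j (Finset.mem_range.1 hj)
    linarith

section interpolation

variable {M : ℕ} {x : ℕ → ℝ} {G W : ℝ → ℝ} {h δ δ' : ℝ}

theorem cellSlope_add (G W : ℝ → ℝ) (x : ℕ → ℝ) (j : ℕ) :
    cellSlope (fun t => G t + W t) x j = cellSlope G x j + cellSlope W x j := by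
  simp only [cellSlope]; ring

/-- On a cell both `G - G(x j)` and the linear part of its interpolant are bounded through the local
Dirichlet integral, which gives first order in `h`; the smooth part enters only through its uniform
error `δ`. -/
theorem interp_error_sq_le (h0 : x 0 = -1) (hM : x M = 1) (hx : ∀ j < M, x j < x (j + 1))
    (hh : ∀ j < M, x (j + 1) - x j ≤ h) (hG : IsAC G) (hW : ContDiff ℝ 1 W)
    (hU : G (x 0) + W (x 0) = 0)
    (hδ : ∀ j < M, ∀ t ∈ Icc (x j) (x (j + 1)),
      |W t - W (x j) - cellSlope W x j * (t - x j)| ≤ δ) :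
    ∫ t, (G t + W t - reluSum M x (slopeChange (cellSlope (fun t => G t + W t) x)) t) ^ 2 ∂volI
      ≤ 8 * h ^ 2 * ∫ t, deriv G t ^ 2 ∂volI + 2 * (2 * δ ^ 2) := by
  have mem : ∀ j ≤ M, x j ∈ Icc (-1 : ℝ) 1 := fun j hj =>
    ⟨h0 ▸ mesh_monotone hx (Nat.zero_le j) hj, hM ▸ mesh_monotone hx hj le_rfl⟩
  have i1 := integrable_sq_of_memLp_two
    ((hG.add (isAC_of_contDiff hW)).sub (isAC_reluSum M x
      (slopeChange (cellSlope (fun t => G t + W t) x)))).memLp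
  refine integral_le_of_cells h0 hM hx i1 (integrable_sq_of_memLp_two hG.2) fun j hj => ?_
  have m1 := mem j hj.le
  have m2 := mem (j + 1) hj
  have hlt := hx j hj
  have hpos : 0 < x (j + 1) - x j := sub_pos.2 hlt
  set D := ∫ t in x j..x (j + 1), deriv G t ^ 2 with hD
  have D0 : 0 ≤ D := intervalIntegral.integral_nonneg hlt.le fun _ _ => sq_nonneg _
  have hG1 := hG.sq_sub_le m1 m2 hlt.le
  calc ∫ t in x j..x (j + 1),
        (G t + W t - reluSum M x (slopeChange (cellSlope (fun t => G t + W t) x)) t) ^ 2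
      ≤ ∫ t in x j..x (j + 1), (8 * ((x (j + 1) - x j) * D) + 2 * δ ^ 2) := by
        refine intervalIntegral.integral_mono_on hlt.le (intervalIntegrable_sub i1 m1 m2)
          intervalIntegrable_const fun t ht => ?_
        rw [reluSum_interp hx hU hj ht, cellSlope_add]
        have mt : t ∈ Icc (-1 : ℝ) 1 := ⟨m1.1.trans ht.1, ht.2.trans m2.2⟩
        have hG2 : (G t - G (x j)) ^ 2 ≤ (x (j + 1) - x j) * D := by
          refine (hG.sq_sub_le m1 mt ht.1).trans ?_
          have : ∫ t in x j..t, deriv G t ^ 2 ≤ D :=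
            intervalIntegral.integral_mono_interval le_rfl ht.1 ht.2
              (Filter.Eventually.of_forall fun _ => sq_nonneg _)
              (intervalIntegrable_sub (integrable_sq_of_memLp_two hG.2) m1 m2)
          exact mul_le_mul (by linarith [ht.2]) this
            (intervalIntegral.integral_nonneg ht.1 fun _ _ => sq_nonneg _) hpos.le
        have hG3 : (cellSlope G x j * (t - x j)) ^ 2 ≤ (x (j + 1) - x j) * D := by
          refine le_trans ?_ hG1
          have : cellSlope G x j * (t - x j) =
              (G (x (j + 1)) - G (x j)) * ((t - x j) / (x (j + 1) - x j)) := by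
            rw [cellSlope]; ring
          rw [this, mul_pow]
          refine mul_le_of_le_one_right (sq_nonneg _) (pow_le_one₀ ?_ ?_)
          · exact div_nonneg (by linarith [ht.1]) hpos.le
          · rw [div_le_one hpos]; linarith [ht.2]
        have hW1 := sq_le_sq' (abs_le.1 (hδ j hj t ht)).1 (abs_le.1 (hδ j hj t ht)).2
        have e : G t + W t - (G (x j) + W (x j) + (cellSlope G x j + cellSlope W x j) * (t - x j))
          = (G t - G (x j)) - cellSlope G x j * (t - x j)
            + (W t - W (x j) - cellSlope W x j * (t - x j)) := by ring
        have gen (a b c : ℝ) : (a - b + c) ^ 2 ≤ 4 * a ^ 2 + 4 * b ^ 2 + 2 * c ^ 2 := by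
          nlinarith [sq_nonneg (a - b - c), sq_nonneg (a + b)]
        rw [e]
        refine (gen _ _ _).trans ?_
        linarith
    _ = 8 * (x (j + 1) - x j) ^ 2 * D + 2 * δ ^ 2 * (x (j + 1) - x j) := by
        rw [intervalIntegral.integral_const, smul_eq_mul]; ring
    _ ≤ 8 * h ^ 2 * D + 2 * δ ^ 2 * (x (j + 1) - x j) := by
        have := hh j hj
        gcongr

/-- The cell slope of `G` is the mean of `G'`, so interpolation is stable in the `H¹` seminorm. No
power of `h` is gained; smallness comes later from the factor `ε`. -/
theorem interp_deriv_error_sq_le (h0 : x 0 = -1) (hM : x M = 1) (hx : ∀ j < M, x j < x (j + 1))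
    (hG : IsAC G) (hW : ContDiff ℝ 1 W) (hU : G (x 0) + W (x 0) = 0)
    (hδ : ∀ j < M, ∀ t ∈ Icc (x j) (x (j + 1)), |deriv W t - cellSlope W x j| ≤ δ') :
    ∫ t, (deriv (fun t => G t + W t) t -
        deriv (reluSum M x (slopeChange (cellSlope (fun t => G t + W t) x))) t) ^ 2 ∂volI
      ≤ 6 * ∫ t, deriv G t ^ 2 ∂volI + 2 * (3 * δ' ^ 2) := by
  have mem : ∀ j ≤ M, x j ∈ Icc (-1 : ℝ) 1 := fun j hj =>
    ⟨h0 ▸ mesh_monotone hx (Nat.zero_le j) hj, hM ▸ mesh_monotone hx hj le_rfl⟩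
  have i1 := integrable_sq_of_memLp_two
    ((hG.add (isAC_of_contDiff hW)).2.sub (isAC_reluSum M x
      (slopeChange (cellSlope (fun t => G t + W t) x))).2)
  refine integral_le_of_cells h0 hM hx i1 (integrable_sq_of_memLp_two hG.2) fun j hj => ?_
  have m1 := mem j hj.le
  have m2 := mem (j + 1) hj
  have hlt := hx j hj
  have hpos : 0 < x (j + 1) - x j := sub_pos.2 hlt
  have iG := intervalIntegrable_sub (integrable_sq_of_memLp_two hG.2) m1 m2
  have hG1 := hG.sq_sub_le m1 m2 hlt.le
  have hdiff : ∀ᵐ t, t ∈ Icc (-1 : ℝ) 1 →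
      deriv (fun t => G t + W t) t = deriv G t + deriv W t := by
    filter_upwards [hG.1.ae_differentiableAt] with t ht hI
    exact deriv_fun_add (ht (uIcc_I ▸ hI)) ((hW.differentiable (by norm_num)) t)
  calc ∫ t in x j..x (j + 1), (deriv (fun t => G t + W t) t -
        deriv (reluSum M x (slopeChange (cellSlope (fun t => G t + W t) x))) t) ^ 2
      ≤ ∫ t in x j..x (j + 1), (3 * deriv G t ^ 2 + 3 * (cellSlope G x j ^ 2 + δ' ^ 2)) := by
        refine intervalIntegral.integral_mono_ae_restrict hlt.le (intervalIntegrable_sub i1 m1 m2)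
          ((iG.const_mul 3).add intervalIntegrable_const) ?_
        refine (ae_restrict_iff' measurableSet_Icc).2 ?_
        -- The interpolant may have kinks at the nodes, which form a null set.
        have n1 : ∀ᵐ t : ℝ, t ≠ x j := by simp [ae_iff, measure_singleton]
        have n2 : ∀ᵐ t : ℝ, t ≠ x (j + 1) := by simp [ae_iff, measure_singleton]
        filter_upwards [hdiff, n1, n2] with t ht t1 t2 hI
        have mt : t ∈ Icc (-1 : ℝ) 1 := ⟨m1.1.trans hI.1, hI.2.trans m2.2⟩
        rw [ht mt, deriv_reluSum_interp hx hU hj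
          ⟨lt_of_le_of_ne hI.1 (Ne.symm t1), lt_of_le_of_ne hI.2 t2⟩, cellSlope_add]
        have hW1 := sq_le_sq' (abs_le.1 (hδ j hj t hI)).1 (abs_le.1 (hδ j hj t hI)).2
        nlinarith [sq_nonneg (deriv G t + cellSlope G x j),
          sq_nonneg (deriv G t - (deriv W t - cellSlope W x j)),
          sq_nonneg (cellSlope G x j + (deriv W t - cellSlope W x j))]
    _ = 3 * (∫ t in x j..x (j + 1), deriv G t ^ 2) +
          3 * (cellSlope G x j ^ 2 * (x (j + 1) - x j)) + 3 * δ' ^ 2 * (x (j + 1) - x j) := by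
        rw [intervalIntegral.integral_add (iG.const_mul 3) intervalIntegrable_const,
          intervalIntegral.integral_const, intervalIntegral.integral_const_mul, smul_eq_mul]
        ring
    _ ≤ 6 * (∫ t in x j..x (j + 1), deriv G t ^ 2) + 3 * δ' ^ 2 * (x (j + 1) - x j) := by
        have : cellSlope G x j ^ 2 * (x (j + 1) - x j) ≤ ∫ t in x j..x (j + 1), deriv G t ^ 2 := by
          have e : cellSlope G x j ^ 2 * (x (j + 1) - x j) =
              (G (x (j + 1)) - G (x j)) ^ 2 / (x (j + 1) - x j) := by
            rw [cellSlope]; field_simp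
          rw [e, div_le_iff₀' hpos]
          exact hG1
        linarith

end interpolation

/-! ### Interpolation of exponential layers -/

/-- By monotonicity the function and its chord both stay between the end values, so they differ by
at most the oscillation `κ`. The slope of the chord is the derivative at an intermediate point, and
derivatives are `s` times values. -/
theorem exp_affine_interp {s c x y κ : ℝ} (hxy : x < y)
    (hκ : |Real.exp (s * y + c) - Real.exp (s * x + c)| ≤ κ) {t : ℝ} (ht : t ∈ Icc x y) :
    |Real.exp (s * t + c) - Real.exp (s * x + c) -
        (Real.exp (s * y + c) - Real.exp (s * x + c)) / (y - x) * (t - x)| ≤ κ ∧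
      |s * Real.exp (s * t + c) - (Real.exp (s * y + c) - Real.exp (s * x + c)) / (y - x)|
        ≤ |s| * κ := by
  have hpos : 0 < y - x := sub_pos.2 hxy
  have mono : ∀ r ∈ Icc x y, Real.exp (s * r + c) ∈
      uIcc (Real.exp (s * x + c)) (Real.exp (s * y + c)) := by
    intro r hr
    rcases le_total 0 s with hs | hs
    · refine mem_uIcc.2 (Or.inl ⟨?_, ?_⟩) <;> gcongr
      · exact hr.1
      · exact hr.2
    · refine mem_uIcc.2 (Or.inr ⟨?_, ?_⟩) <;> rw [Real.exp_le_exp] <;>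
        nlinarith [hr.1, hr.2]
  have line : Real.exp (s * x + c) +
      (Real.exp (s * y + c) - Real.exp (s * x + c)) / (y - x) * (t - x) ∈
      uIcc (Real.exp (s * x + c)) (Real.exp (s * y + c)) := by
    have k0 : 0 ≤ (t - x) / (y - x) := div_nonneg (by linarith [ht.1]) hpos.le
    have k1 : (t - x) / (y - x) ≤ 1 := by rw [div_le_one hpos]; linarith [ht.2]
    have e : (Real.exp (s * y + c) - Real.exp (s * x + c)) / (y - x) * (t - x) =
      (Real.exp (s * y + c) - Real.exp (s * x + c)) * ((t - x) / (y - x)) := by ring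
    rw [e]
    rcases le_total (Real.exp (s * x + c)) (Real.exp (s * y + c)) with hs | hs
    · refine mem_uIcc.2 (Or.inl ⟨?_, ?_⟩) <;> nlinarith
    · refine mem_uIcc.2 (Or.inr ⟨?_, ?_⟩) <;> nlinarith
  have dist_le : ∀ p ∈ uIcc (Real.exp (s * x + c)) (Real.exp (s * y + c)),
      ∀ q ∈ uIcc (Real.exp (s * x + c)) (Real.exp (s * y + c)), |p - q| ≤ κ := fun p hp q hq =>
    (Set.abs_sub_le_of_uIcc_subset_uIcc (uIcc_subset_uIcc hq hp)).trans hκ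
  constructor
  · have := dist_le _ (mono t ht) _ line
    rwa [← sub_sub] at this
  · obtain ⟨ξ, hξ, he⟩ := exists_hasDerivAt_eq_slope (fun t => Real.exp (s * t + c))
      (fun t => s * Real.exp (s * t + c)) hxy (by fun_prop)
      fun t _ => hasDerivAt_exp_affine s c t
    rw [← he, ← mul_sub, abs_mul]
    gcongr
    exact dist_le _ (mono t ht) _ (mono ξ (Ioo_subset_Icc_self hξ))

theorem layers_interp {α₁ α₂ a₁ a₂ p q κ₁ κ₂ : ℝ} {x : ℕ → ℝ} {j : ℕ} (hx : x j < x (j + 1))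
    (pa₁ : 0 < a₁) (pa₂ : 0 < a₂)
    (h1 : |Real.exp (-a₁ * x (j + 1) + -a₁) - Real.exp (-a₁ * x j + -a₁)| ≤ κ₁)
    (h2 : |Real.exp (a₂ * x (j + 1) + -a₂) - Real.exp (a₂ * x j + -a₂)| ≤ κ₂)
    {t : ℝ} (ht : t ∈ Icc (x j) (x (j + 1))) :
    |layers α₁ α₂ a₁ a₂ p q t - layers α₁ α₂ a₁ a₂ p q (x j)
        - cellSlope (layers α₁ α₂ a₁ a₂ p q) x j * (t - x j)| ≤ |α₁| * κ₁ + |α₂| * κ₂ ∧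
      |deriv (layers α₁ α₂ a₁ a₂ p q) t - cellSlope (layers α₁ α₂ a₁ a₂ p q) x j|
        ≤ |α₁| * (a₁ * κ₁) + |α₂| * (a₂ * κ₂) := by
  have b1 := exp_affine_interp hx h1 ht
  have b2 := exp_affine_interp hx h2 ht
  rw [abs_neg, abs_of_pos pa₁] at b1
  rw [abs_of_pos pa₂] at b2
  set E₁ := fun t => Real.exp (-a₁ * t + -a₁)
  set E₂ := fun t => Real.exp (a₂ * t + -a₂)
  have hpos : x (j + 1) - x j ≠ 0 := sub_ne_zero.2 hx.ne'
  have es : cellSlope (layers α₁ α₂ a₁ a₂ p q) x j =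
      α₁ * ((E₁ (x (j + 1)) - E₁ (x j)) / (x (j + 1) - x j)) +
      α₂ * ((E₂ (x (j + 1)) - E₂ (x j)) / (x (j + 1) - x j)) + p := by
    simp only [cellSlope, layers, E₁, E₂]
    field_simp
    ring
  rw [(layers_hasDerivAt α₁ α₂ a₁ a₂ p q t).deriv, es]
  constructor
  · have e : layers α₁ α₂ a₁ a₂ p q t - layers α₁ α₂ a₁ a₂ p q (x j) -
        (α₁ * ((E₁ (x (j + 1)) - E₁ (x j)) / (x (j + 1) - x j)) +
          α₂ * ((E₂ (x (j + 1)) - E₂ (x j)) / (x (j + 1) - x j)) + p) * (t - x j) =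
        α₁ * (E₁ t - E₁ (x j) - (E₁ (x (j + 1)) - E₁ (x j)) / (x (j + 1) - x j) * (t - x j)) +
        α₂ * (E₂ t - E₂ (x j) - (E₂ (x (j + 1)) - E₂ (x j)) / (x (j + 1) - x j) * (t - x j)) := by
      simp only [layers, E₁, E₂]; ring
    rw [e]
    refine (abs_add_le _ _).trans ?_
    rw [abs_mul, abs_mul]
    exact add_le_add (mul_le_mul_of_nonneg_left b1.1 (abs_nonneg _))
      (mul_le_mul_of_nonneg_left b2.1 (abs_nonneg _))
  · have e : α₁ * (-a₁ * Real.exp (-a₁ * t + -a₁)) + α₂ * (a₂ * Real.exp (a₂ * t + -a₂)) + p -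
        (α₁ * ((E₁ (x (j + 1)) - E₁ (x j)) / (x (j + 1) - x j)) +
          α₂ * ((E₂ (x (j + 1)) - E₂ (x j)) / (x (j + 1) - x j)) + p) =
        α₁ * (-a₁ * E₁ t - (E₁ (x (j + 1)) - E₁ (x j)) / (x (j + 1) - x j)) +
        α₂ * (a₂ * E₂ t - (E₂ (x (j + 1)) - E₂ (x j)) / (x (j + 1) - x j)) := by
      simp only [E₁, E₂]; ring
    rw [e]
    refine (abs_add_le _ _).trans ?_
    rw [abs_mul, abs_mul]
    exact add_le_add (mul_le_mul_of_nonneg_left b1.2 (abs_nonneg _))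
      (mul_le_mul_of_nonneg_left b2.2 (abs_nonneg _))

/-! ### Approximation on layer-adapted meshes -/

/-- Meshes `-1 = x 0 < ... < x M = 1` on which the layers `exp (-β (1 ± t) / ε)` are resolved up
to `κ`. -/
structure LayerMesh (β ε κ : ℝ) (M : ℕ) (x : ℕ → ℝ) : Prop where
  zero : x 0 = -1
  last : x M = 1
  lt : ∀ j < M, x j < x (j + 1)
  width : ∀ j < M, x (j + 1) - x j ≤ κ
  left : ∀ j < M, (x (j + 1) - x j) / ε * Real.exp (-(β * (x j + 1) / ε)) ≤ κ ∨
    Real.exp (-(β * (x j + 1) / ε)) ≤ κ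
  right : ∀ j < M, (x (j + 1) - x j) / ε * Real.exp (-(β * (1 - x (j + 1)) / ε)) ≤ κ ∨
    Real.exp (-(β * (1 - x (j + 1)) / ε)) ≤ κ

/-- On a cell short relative to the layer, `1 - exp (-y) ≤ y` bounds the oscillation; otherwise the
layer has already decayed below `κ` at the cell end nearest to the boundary. Decay at the lower rate
`β` is enough since `σ ≥ β`, which is why the mesh can be built from the lower bound of `b` alone.
-/
theorem exp_oscillation_le {σ β ε κ d h : ℝ} (hε : 0 < ε) (hβ : 0 < β) (hσ : β ≤ σ) (hd : 0 ≤ d)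
    (hh : 0 ≤ h) (hc : h / ε * Real.exp (-(β * d / ε)) ≤ κ ∨ Real.exp (-(β * d / ε)) ≤ κ) :
    |Real.exp (-(σ / ε * d)) - Real.exp (-(σ / ε * (d + h)))| ≤ (σ + 1) * κ := by
  have hs : 0 < σ := hβ.trans_le hσ
  have hle : Real.exp (-(σ / ε * (d + h))) ≤ Real.exp (-(σ / ε * d)) := by
    rw [Real.exp_le_exp]
    have : 0 ≤ σ / ε * h := by positivity
    linarith
  have hdec : Real.exp (-(σ / ε * d)) ≤ Real.exp (-(β * d / ε)) := by
    rw [Real.exp_le_exp, neg_le_neg_iff, mul_div_right_comm]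
    gcongr
  rw [abs_of_nonneg (sub_nonneg.2 hle)]
  rcases hc with hc | hc
  · have hκ : 0 ≤ κ := le_trans (by positivity) hc
    have h1 : Real.exp (-(σ / ε * (d + h))) = Real.exp (-(σ / ε * d)) * Real.exp (-(σ / ε * h)) := by
      rw [← Real.exp_add]; congr 1; ring
    have h2 : 1 - Real.exp (-(σ / ε * h)) ≤ σ / ε * h := by
      linarith [Real.add_one_le_exp (-(σ / ε * h))]
    calc Real.exp (-(σ / ε * d)) - Real.exp (-(σ / ε * (d + h)))
        = Real.exp (-(σ / ε * d)) * (1 - Real.exp (-(σ / ε * h))) := by rw [h1]; ring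
      _ ≤ Real.exp (-(σ / ε * d)) * (σ / ε * h) := by gcongr
      _ ≤ Real.exp (-(β * d / ε)) * (σ / ε * h) := by gcongr
      _ = σ * (h / ε * Real.exp (-(β * d / ε))) := by ring
      _ ≤ σ * κ := by gcongr
      _ ≤ (σ + 1) * κ := by linarith
  · have hκ : 0 ≤ κ := (Real.exp_pos _).le.trans hc
    have : 0 ≤ σ * κ := by positivity
    linarith [Real.exp_pos (-(σ / ε * (d + h)))]

theorem integral_sq_triangle {f g h : ℝ → ℝ} (hf : MemLp f 2 volI) (hg : MemLp g 2 volI)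
    (hh : MemLp h 2 volI) : ∫ x, (f x - h x) ^ 2 ∂volI ≤
      2 * ∫ x, (f x - g x) ^ 2 ∂volI + 2 * ∫ x, (g x - h x) ^ 2 ∂volI := by
  have i1 := (integrable_sq_of_memLp_two (hf.sub hg)).const_mul 2
  have i2 := (integrable_sq_of_memLp_two (hg.sub hh)).const_mul 2
  simp only [Pi.sub_apply] at i1 i2
  rw [← integral_const_mul, ← integral_const_mul, ← integral_add i1 i2]
  refine integral_mono (integrable_sq_of_memLp_two (hf.sub hh)) (i1.fun_add i2) fun x => ?_
  simp only
  nlinarith [sq_nonneg (f x - g x - (g x - h x))]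

theorem layers_interp_layerMesh {σ₁ σ₂ α₁ α₂ p q β ε κ : ℝ} {M : ℕ} {x : ℕ → ℝ}
    (hm : LayerMesh β ε κ M x) (hε : 0 < ε) (hβ : 0 < β) (h₁ : β ≤ σ₁) (h₂ : β ≤ σ₂) {j : ℕ}
    (hj : j < M) {t : ℝ} (ht : t ∈ Icc (x j) (x (j + 1))) {W : ℝ → ℝ}
    (hW : W = layers α₁ α₂ (σ₁ / ε) (σ₂ / ε) p q) :
    |W t - W (x j) - cellSlope W x j * (t - x j)| ≤
        (|α₁| * (σ₁ + 1) + |α₂| * (σ₂ + 1)) * κ ∧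
      |deriv W t - cellSlope W x j| ≤
        (|α₁| * (σ₁ * (σ₁ + 1)) + |α₂| * (σ₂ * (σ₂ + 1))) * κ / ε := by
  have hlt := hm.lt j hj
  have xj : -1 ≤ x j := hm.zero ▸ mesh_monotone hm.lt (Nat.zero_le j) hj.le
  have xj' : x (j + 1) ≤ 1 := hm.last ▸ mesh_monotone hm.lt hj le_rfl
  have o1 := exp_oscillation_le hε hβ h₁ (by linarith) (sub_pos.2 hlt).le (hm.left j hj)
  have o2 := exp_oscillation_le hε hβ h₂ (by linarith) (sub_pos.2 hlt).le (hm.right j hj)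
  have L := layers_interp (α₁ := α₁) (α₂ := α₂) (p := p) (q := q)
    (κ₁ := (σ₁ + 1) * κ) (κ₂ := (σ₂ + 1) * κ) hlt (div_pos (hβ.trans_le h₁) hε)
    (div_pos (hβ.trans_le h₂) hε) (by
      rw [abs_sub_comm]; refine le_trans (le_of_eq ?_) o1; congr 3 <;> ring) (by
      refine le_trans (le_of_eq ?_) o2; congr 3 <;> ring) ht
  rw [← hW] at L
  refine ⟨L.1.trans (le_of_eq (by ring)), L.2.trans (le_of_eq (by ring))⟩

/-- The interpolated function is the explicit `U = G + W`, not `u`. The expansion error and the `H¹`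
part cost `O(ε)`, absorbed by `ε ≤ κ`; the layer derivative error `O(κ / ε)` is compensated by the
weight `ε`. -/
theorem exists_reluSum_approx {bLow bUp : ℝ} {b f B F : ℝ → ℝ} (hbLow : 0 < bLow)
    (hbb : ∀ᵐ x ∂volI, bLow ≤ b x ∧ b x ≤ bUp) (hB : IsAC B) (hF : IsAC F)
    (hbB : b =ᵐ[volI] B) (hfF : f =ᵐ[volI] F) :
    ∃ K > (0 : ℝ), ∀ ε : ℝ, 0 < ε → ε ≤ 1 → ∀ u v : ℝ → ℝ, IsWeakSolution ε b f u → IsAC v →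
      u =ᵐ[volI] v → v (-1) = 0 → v 1 = 0 → ∀ κ : ℝ, ε ≤ κ → ∀ (M : ℕ) (x : ℕ → ℝ),
      LayerMesh (√bLow) ε κ M x → ∃ s : ℕ → ℝ,
        reluSum M x (slopeChange s) (-1) = 0 ∧ reluSum M x (slopeChange s) 1 = 0 ∧
        ε ^ 2 * ∫ x', (deriv v x' - deriv (reluSum M x (slopeChange s)) x') ^ 2 ∂volI
          + ∫ x', (v x' - reluSum M x (slopeChange s) x') ^ 2 ∂volI ≤ K * κ ^ 2 := by
  have hBm : ∀ x ∈ Icc (-1 : ℝ) 1, bLow ≤ B x := le_of_ae_le (ac_continuousOn hB.1) (by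
    filter_upwards [hbb, hbB] with x h1 h2
    rw [← h2]; exact h1.1)
  obtain ⟨K, hK, H⟩ := asymptotic_expansion hbLow hbb hB hF hbB hfF hBm
  have hG := hF.div hbLow hB hBm
  set G : ℝ → ℝ := fun x => F x / B x
  set DG := ∫ x, deriv G x ^ 2 ∂volI with hDG
  have DG0 : 0 ≤ DG := integral_nonneg fun _ => sq_nonneg _
  have s₁ : √bLow ≤ √(B (-1)) := Real.sqrt_le_sqrt (hBm (-1) (by simp))
  have s₂ : √bLow ≤ √(B 1) := Real.sqrt_le_sqrt (hBm 1 (by simp))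
  set α₁ := -(F (-1) / B (-1))
  set α₂ := -(F 1 / B 1)
  set T := |α₁| * (√(B (-1)) + 1) + |α₂| * (√(B 1) + 1) with hT
  set T' := |α₁| * (√(B (-1)) * (√(B (-1)) + 1)) + |α₂| * (√(B 1) * (√(B 1) + 1)) with hT'
  refine ⟨2 * K + 28 * DG + 8 * T ^ 2 + 12 * T' ^ 2, by positivity,
    fun ε hε hε1 u v hu hv huv v0 v1 κ hεκ M x hm => ?_⟩
  obtain ⟨p, q, h⟩ := H ε hε hε1 u v hu hv huv v0 v1
  obtain ⟨W0, W1, hUv⟩ := h _ rfl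
  set W := layers α₁ α₂ (√(B (-1)) / ε) (√(B 1) / ε) p q with hW
  have hWc : ContDiff ℝ 1 W := layers_contDiff _ _ _ _ _ _
  have hU : IsAC fun x => G x + W x := hG.add (isAC_of_contDiff hWc)
  have hU0 : G (x 0) + W (x 0) = 0 := by rw [hm.zero]; exact W0
  have hUM : G (x M) + W (x M) = 0 := by rw [hm.last]; exact W1
  set s := cellSlope (fun t => G t + W t) x with hs
  have hV := isAC_reluSum M x (slopeChange s)
  have I1 := interp_error_sq_le hm.zero hm.last hm.lt hm.width hG hWc hU0 fun j hj t ht =>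
    (layers_interp_layerMesh hm hε (Real.sqrt_pos.2 hbLow) s₁ s₂ hj ht hW).1
  have I2 := interp_deriv_error_sq_le hm.zero hm.last hm.lt hG hWc hU0 fun j hj t ht =>
    (layers_interp_layerMesh hm hε (Real.sqrt_pos.2 hbLow) s₁ s₂ hj ht hW).2
  have T1 := integral_sq_triangle hv.2 hU.2 hV.2
  have T2 := integral_sq_triangle hv.memLp hU.memLp hV.memLp
  refine ⟨s, ?_, ?_, ?_⟩
  · rw [← hm.zero, reluSum_node hm.lt hU0 (Nat.zero_le M), hU0]
  · rw [← hm.last, reluSum_node hm.lt hU0 le_rfl, hUM]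
  rw [← hs, ← hT, ← hDG] at I1
  rw [← hs, ← hT', ← hDG] at I2
  have I2' := mul_le_mul_of_nonneg_left I2 (sq_nonneg ε)
  have T1' := mul_le_mul_of_nonneg_left T1 (sq_nonneg ε)
  have hεκ2 : ε ^ 2 ≤ κ ^ 2 := by gcongr
  have e1 : ε ^ 2 * (6 * DG + 2 * (3 * (T' * κ / ε) ^ 2)) = 6 * DG * ε ^ 2 + 6 * T' ^ 2 * κ ^ 2 := by
    field_simp
    ring
  rw [e1] at I2'
  have z1 : K * ε ^ 2 ≤ K * κ ^ 2 := by gcongr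
  have z2 : DG * ε ^ 2 ≤ DG * κ ^ 2 := by gcongr
  nlinarith

/-! ### S-type meshes -/

section sType

variable {θ ε : ℝ} {φ : ℝ → ℝ} {n : ℕ}

theorem sTypeNode_left {i : ℕ} (hi : i ≤ n) :
    sTypeNode θ ε φ (4 * n) i = -1 + θ * ε * φ (2 * i / (4 * n : ℕ)) := by
  rw [sTypeNode]; exact if_pos (by omega)

/-- At the transition index `i = n` the definition uses the left branch, whose value coincides with
the formula of the middle one. -/
theorem sTypeNode_mid (hn : 0 < n) {i : ℕ} (h1 : n ≤ i) (h2 : i ≤ 3 * n) :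
    sTypeNode θ ε φ (4 * n) i =
      4 * i / (4 * n : ℕ) * (1 - θ * ε * φ (1 / 2)) - 2 + 2 * (θ * ε * φ (1 / 2)) := by
  have hn' : (n : ℝ) ≠ 0 := by positivity
  rcases h1.eq_or_lt with rfl | h1
  · rw [sTypeNode_left le_rfl]
    have e1 : 2 * (n : ℝ) / (4 * n : ℕ) = 1 / 2 := by push_cast; field_simp; norm_num
    have e2 : 4 * (n : ℝ) / (4 * n : ℕ) = 1 := by push_cast; field_simp
    rw [e1, e2]; ring
  · simp only [sTypeNode]
    rw [if_neg (by omega), if_pos (by omega)]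

theorem sTypeNode_right (hn : 0 < n) {i : ℕ} (hi : i ≤ n) :
    sTypeNode θ ε φ (4 * n) (4 * n - i) = 1 - θ * ε * φ (2 * i / (4 * n : ℕ)) := by
  have hn' : (n : ℝ) ≠ 0 := by positivity
  have hc : ((4 * n - i : ℕ) : ℝ) = 4 * n - i := by
    rw [Nat.cast_sub (by omega)]; push_cast; ring
  rcases hi.eq_or_lt with rfl | hi
  · rw [sTypeNode_mid hn (by omega) (by omega), hc]
    have e1 : 2 * (i : ℝ) / (4 * i : ℕ) = 1 / 2 := by push_cast; field_simp; norm_num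
    have e2 : 4 * (4 * (i : ℝ) - i) / (4 * i : ℕ) = 3 := by push_cast; field_simp; norm_num
    rw [e1, e2]; ring
  · simp only [sTypeNode]
    rw [if_neg (by omega), if_neg (by omega), hc]
    congr 3
    push_cast
    field_simp
    ring

/-- Left fine cells resolve the left layer directly, and beyond the transition point that layer is
below its value there, `exp (-(β θ φ(1/2)))`. The right layer follows by the reflection `i ↦ 4 n -
i`, so conditions on `φ` on the left fine cells suffice. -/
theorem sTypeNode_layerMesh {β κ : ℝ} (hn : 0 < n) (hε : 0 < ε) (hθ : 0 < θ) (hβ : 0 < β)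
    (hφ0 : φ 0 = 0) (hlam0 : 0 ≤ φ (1 / 2)) (hlam : θ * ε * φ (1 / 2) < 1)
    (hφ : ∀ i < n, φ (2 * i / (4 * n : ℕ)) < φ (2 * (i + 1 : ℕ) / (4 * n : ℕ)))
    (hw : ∀ i < n, θ * ε * (φ (2 * (i + 1 : ℕ) / (4 * n : ℕ)) - φ (2 * i / (4 * n : ℕ))) ≤ κ)
    (hw' : 4 / ((4 * n : ℕ) : ℝ) ≤ κ)
    (hfine : ∀ i < n, θ * (φ (2 * (i + 1 : ℕ) / (4 * n : ℕ)) - φ (2 * i / (4 * n : ℕ))) *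
      Real.exp (-(β * θ * φ (2 * i / (4 * n : ℕ)))) ≤ κ)
    (hcoarse : Real.exp (-(β * θ * φ (1 / 2))) ≤ κ) :
    LayerMesh β ε κ (4 * n) (sTypeNode θ ε φ (4 * n)) := by
  have hn' : (0 : ℝ) < n := by positivity
  have hcast : ((4 * n : ℕ) : ℝ) = 4 * n := by push_cast; ring
  set lam := θ * ε * φ (1 / 2) with hlam_def
  have lam0 : 0 ≤ lam := by positivity
  set x := sTypeNode θ ε φ (4 * n) with hx
  have L {i : ℕ} (hi : i ≤ n) : x i = -1 + θ * ε * φ (2 * i / (4 * n : ℕ)) := sTypeNode_left hi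
  have Md {i : ℕ} (h1 : n ≤ i) (h2 : i ≤ 3 * n) :
      x i = 4 * i / (4 * n : ℕ) * (1 - lam) - 2 + 2 * lam := sTypeNode_mid hn h1 h2
  have R {i : ℕ} (hi : i ≤ n) : x (4 * n - i) = 1 - θ * ε * φ (2 * i / (4 * n : ℕ)) :=
    sTypeNode_right hn hi
  have xn : x n = -1 + lam := by
    rw [Md le_rfl (by omega)]
    have : 4 * (n : ℝ) / (4 * n : ℕ) = 1 := by push_cast; field_simp
    rw [this]; ring
  have x3n : x (3 * n) = 1 - lam := by
    rw [Md (by omega) le_rfl]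
    have : 4 * ((3 * n : ℕ) : ℝ) / (4 * n : ℕ) = 3 := by push_cast; field_simp
    rw [this]; ring
  have cases : ∀ j < 4 * n,
      (j < n ∧ x (j + 1) - x j =
        θ * ε * (φ (2 * (j + 1 : ℕ) / (4 * n : ℕ)) - φ (2 * j / (4 * n : ℕ)))) ∨
      (n ≤ j ∧ j < 3 * n ∧ x (j + 1) - x j = 4 / (4 * n : ℕ) * (1 - lam)) ∨
      (3 * n ≤ j ∧ ∃ i < n, x (j + 1) = 1 - θ * ε * φ (2 * i / (4 * n : ℕ)) ∧
        x (j + 1) - x j =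
          θ * ε * (φ (2 * (i + 1 : ℕ) / (4 * n : ℕ)) - φ (2 * i / (4 * n : ℕ)))) := by
    intro j hj
    rcases lt_or_ge j n with h1 | h1
    · refine Or.inl ⟨h1, ?_⟩
      rw [L h1, L h1.le]; ring
    rcases lt_or_ge j (3 * n) with h2 | h2
    · refine Or.inr (Or.inl ⟨h1, h2, ?_⟩)
      rw [Md (by omega) h2, Md h1 h2.le]; push_cast; ring
    · refine Or.inr (Or.inr ⟨h2, 4 * n - (j + 1), by omega, ?_⟩)
      have e1 : j + 1 = 4 * n - (4 * n - (j + 1)) := by omega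
      have e2 : j = 4 * n - (4 * n - (j + 1) + 1) := by omega
      have r1 := R (i := 4 * n - (j + 1)) (by omega)
      have r2 := R (i := 4 * n - (j + 1) + 1) (by omega)
      rw [← e1] at r1
      rw [← e2] at r2
      exact ⟨r1, by rw [r1, r2]; ring⟩
  have hθε : 0 < θ * ε := mul_pos hθ hε
  have hlt : ∀ j < 4 * n, x j < x (j + 1) := by
    intro j hj
    rw [← sub_pos]
    rcases cases j hj with ⟨h1, h2⟩ | ⟨-, -, h2⟩ | ⟨-, i, hi, -, h2⟩ <;> rw [h2]
    · exact mul_pos hθε (sub_pos.2 (hφ j h1))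
    · exact mul_pos (by positivity) (by linarith)
    · exact mul_pos hθε (sub_pos.2 (hφ i hi))
  refine ⟨?_, ?_, hlt, ?_, ?_, ?_⟩
  · rw [L (Nat.zero_le n)]; simp [hφ0]
  · have := R (Nat.zero_le n); simpa [hφ0] using this
  · intro j hj
    rcases cases j hj with ⟨h1, h2⟩ | ⟨-, -, h2⟩ | ⟨-, i, hi, -, h2⟩ <;> rw [h2]
    · exact hw j h1
    · refine le_trans (mul_le_of_le_one_right (by positivity) (by linarith)) hw'
    · exact hw i hi
  · intro j hj
    rcases cases j hj with ⟨h1, h2⟩ | h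
    · left
      rw [h2, L h1.le]
      have := hfine j h1
      refine le_trans (le_of_eq ?_) this
      congr 1
      · field_simp
      · congr 2; field_simp; ring
    · right
      have hnj : n ≤ j := by rcases h with h | h <;> omega
      refine le_trans ?_ hcoarse
      rw [Real.exp_le_exp, neg_le_neg_iff, le_div_iff₀ hε]
      have := mesh_monotone hlt hnj hj.le
      calc β * θ * φ (1 / 2) * ε = β * lam := by rw [hlam_def]; ring
        _ ≤ β * (x j + 1) := by gcongr; linarith
  · intro j hj
    rcases cases j hj with ⟨h1, -⟩ | ⟨-, h1, -⟩ | ⟨h1, i, hi, h2, h3⟩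
    pick_goal 3
    · left
      rw [h3, h2]
      have := hfine i hi
      refine le_trans (le_of_eq ?_) this
      congr 1
      · field_simp
      · congr 2; field_simp; ring
    all_goals
      right
      refine le_trans ?_ hcoarse
      rw [Real.exp_le_exp, neg_le_neg_iff, le_div_iff₀ hε]
      have := mesh_monotone hlt (show j + 1 ≤ 3 * n by omega) (by omega)
      calc β * θ * φ (1 / 2) * ε = β * lam := by rw [hlam_def]; ring
        _ ≤ β * (1 - x (j + 1)) := by gcongr; linarith

/-- In the variable stretched by `1 / ε` all fine cells have length `4 θ log N / N`, the source of
the logarithm. Since `β θ = 4`, the layer at the transition point is `N⁻⁴`, well below `N⁻¹`. -/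
theorem shishkinNode_layerMesh {β : ℝ} (hn : 0 < n) (hε : 0 < ε) (hε1 : ε ≤ 1) (hθ : 0 < θ)
    (hβ : 0 < β) (hβθ : β * θ = 4) (hlam : θ * ε * Real.log (4 * n : ℕ) < 1 / 4) :
    LayerMesh β ε ((4 * θ + 4) * (((4 * n : ℕ) : ℝ)⁻¹ * (1 + Real.log (4 * n : ℕ)))) (4 * n)
      (shishkinNode θ ε (4 * n)) := by
  set N : ℝ := ((4 * n : ℕ) : ℝ) with hN
  have hN4 : 4 ≤ N := by rw [hN]; exact_mod_cast (by omega : 4 ≤ 4 * n)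
  have hlog : 0 < Real.log N := Real.log_pos (by linarith)
  have diff (i : ℕ) : 2 * (2 * ((i + 1 : ℕ) : ℝ) / N) * Real.log N
      - 2 * (2 * (i : ℝ) / N) * Real.log N = 4 * (N⁻¹ * Real.log N) := by
    push_cast; field_simp; ring
  have hNinv : 0 < N⁻¹ := by positivity
  have hNl : 0 < N⁻¹ * Real.log N := by positivity
  have hθi : 0 < θ * N⁻¹ := by positivity
  have hθl : 0 < θ * (N⁻¹ * Real.log N) := by positivity
  refine sTypeNode_layerMesh hn hε hθ hβ (by simp) ?_ ?_
    (fun i hi => ?_) (fun i hi => ?_) ?_ (fun i hi => ?_) ?_ <;> try dsimp only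
  · change 0 ≤ 2 * (1 / 2) * Real.log N
    linarith
  · change θ * ε * (2 * (1 / 2) * Real.log N) < 1
    linarith
  · rw [← sub_pos, diff]; positivity
  · rw [diff]
    have : θ * ε * (4 * (N⁻¹ * Real.log N)) ≤ θ * 1 * (4 * (N⁻¹ * Real.log N)) := by gcongr
    linarith
  · rw [← hN, div_eq_mul_inv]
    linarith
  · rw [diff]
    have : θ * (4 * (N⁻¹ * Real.log N)) *
        Real.exp (-(β * θ * (2 * (2 * (i : ℝ) / N) * Real.log N))) ≤
        θ * (4 * (N⁻¹ * Real.log N)) * 1 := by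
      gcongr
      rw [Real.exp_le_one_iff, neg_nonpos, hβθ]
      positivity
    linarith
  · have : Real.exp (-(β * θ * (2 * (1 / 2) * Real.log N))) ≤ N⁻¹ := by
      rw [hβθ, ← Real.exp_log (inv_pos.2 (show 0 < N by linarith)), Real.exp_le_exp,
        Real.log_inv]
      linarith
    linarith

/-- With `s i` the argument of the logarithm in `φ`, the layer at node `i` is `s i ^ 4`, while the
stretched cell length is at most `4 θ N⁻¹ / s (i + 1)`. The decay thus pays for the growing cells,
and the product is `O(1/N)` without a logarithm. -/
theorem expNode_layerMesh {β : ℝ} (hn : 0 < n) (hε : 0 < ε) (hεN : ε ≤ ((4 * n : ℕ) : ℝ)⁻¹)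
    (hθ : 0 < θ) (hβ : 0 < β) (hβθ : β * θ = 4)
    (hlam : θ * ε * Real.log (4 * n : ℕ) < 1 / 4) :
    LayerMesh β ε ((12 * θ + 4) * ((4 * n : ℕ) : ℝ)⁻¹) (4 * n) (expNode θ ε (4 * n)) := by
  set N : ℝ := ((4 * n : ℕ) : ℝ) with hN
  have hNn : N = 4 * n := by rw [hN]; push_cast; ring
  have hN4 : 4 ≤ N := by rw [hN]; exact_mod_cast (by omega : 4 ≤ 4 * n)
  have hN0 : 0 < N := by linarith
  have hNinv : 0 < N⁻¹ := by positivity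
  have hNinv4 : N⁻¹ ≤ 1 / 4 := by rw [inv_le_comm₀ hN0 (by norm_num)]; linarith
  have hθi : 0 < θ * N⁻¹ := by positivity
  set s : ℕ → ℝ := fun i => 1 - 2 * (2 * (i : ℝ) / N) * (1 - 2 / N) with hs
  have s_succ (i : ℕ) : s i - s (i + 1) = 4 * N⁻¹ * (1 - 2 * N⁻¹) := by
    simp only [hs]; push_cast; field_simp; ring
  have s_lb {i : ℕ} (hi : i ≤ n) : 2 * N⁻¹ ≤ s i := by
    have h1 : 2 * (2 * (i : ℝ) / N) ≤ 1 := by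
      have : (i : ℝ) ≤ n := by exact_mod_cast hi
      rw [← mul_div_assoc, div_le_one hN0]; linarith
    have h2 : 0 ≤ 1 - 2 / N := by rw [div_eq_mul_inv]; linarith
    have := mul_le_mul_of_nonneg_right h1 h2
    simp only [hs]
    rw [div_eq_mul_inv 2 N] at this ⊢
    linarith
  have s_pos {i : ℕ} (hi : i ≤ n) : 0 < s i := lt_of_lt_of_le (by positivity) (s_lb hi)
  have s_le (i : ℕ) : s i ≤ 1 := by
    have h2 : 0 ≤ 1 - 2 / N := by rw [div_eq_mul_inv]; linarith
    have : 0 ≤ 2 * (2 * (i : ℝ) / N) * (1 - 2 / N) := by positivity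
    simp only [hs]; linarith
  have half : (1 : ℝ) - 2 * (1 / 2) * (1 - 2 / N) = 2 * N⁻¹ := by rw [div_eq_mul_inv 2 N]; ring
  have diff_le {i : ℕ} (hi : i < n) :
      -Real.log (s (i + 1)) - -Real.log (s i) ≤ 4 * N⁻¹ / s (i + 1) := by
    have p1 := s_pos hi.le
    have p2 := s_pos (i := i + 1) hi
    have e : -Real.log (s (i + 1)) - -Real.log (s i) = Real.log (s i / s (i + 1)) := by
      rw [Real.log_div p1.ne' p2.ne']; ring
    rw [e]
    refine (Real.log_le_sub_one_of_pos (div_pos p1 p2)).trans ?_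
    rw [div_sub_one p2.ne', s_succ]
    have : 4 * N⁻¹ * (1 - 2 * N⁻¹) ≤ 4 * N⁻¹ :=
      mul_le_of_le_one_right (by positivity) (by linarith)
    gcongr
  have diff_pos {i : ℕ} (hi : i < n) : -Real.log (s i) < -Real.log (s (i + 1)) := by
    refine neg_lt_neg (Real.log_lt_log (s_pos hi) ?_)
    have := s_succ i
    have : 0 < 4 * N⁻¹ * (1 - 2 * N⁻¹) := mul_pos (by positivity) (by linarith)
    linarith
  have hpow {r : ℝ} (hr : 0 < r) : Real.exp (-(β * θ * -Real.log r)) = r ^ 4 := by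
    rw [hβθ, mul_neg, neg_neg]
    have := Real.log_pow (n := 4) (x := r)
    push_cast at this
    rw [← this, Real.exp_log (by positivity)]
  refine sTypeNode_layerMesh hn hε hθ hβ (by simp) ?_ ?_ (fun i hi => ?_) (fun i hi => ?_) ?_
    (fun i hi => ?_) ?_ <;> try dsimp only
  · rw [half, neg_nonneg]
    exact Real.log_nonpos (by positivity) (by linarith)
  · have h1 : -Real.log (2 * N⁻¹) ≤ Real.log N := by
      rw [← Real.log_inv]
      refine Real.log_le_log (by positivity) ?_
      rw [mul_inv, inv_inv]; linarith
    rw [half]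
    have := mul_le_mul_of_nonneg_left h1 (mul_pos hθ hε).le
    linarith
  · exact diff_pos hi
  -- Fine cells may be as long as `2 θ ε`, so the width bound relies on `ε ≤ N⁻¹`.
  · have h1 : -Real.log (s (i + 1)) - -Real.log (s i) ≤ 2 := by
      refine (diff_le hi).trans ?_
      rw [div_le_iff₀ (s_pos hi)]
      have := s_lb (i := i + 1) hi
      linarith
    calc θ * ε * (-Real.log (s (i + 1)) - -Real.log (s i)) ≤ θ * N⁻¹ * 2 := by
          have := (sub_pos.2 (diff_pos hi)).le
          gcongr
      _ ≤ (12 * θ + 4) * N⁻¹ := by linarith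
  · rw [← hN, div_eq_mul_inv]; linarith
  · change θ * (-Real.log (s (i + 1)) - -Real.log (s i)) *
      Real.exp (-(β * θ * -Real.log (s i))) ≤ _
    have p1 := s_pos hi.le
    have p2 := s_pos (i := i + 1) hi
    -- One step lowers `s` by at most `4 / N`, which is at most twice the lower bound `2 / N` of
    -- `s`.
    have h3 : s i ≤ 3 * s (i + 1) := by
      have := s_lb (i := i + 1) hi
      have h4 := s_succ i
      have : 4 * N⁻¹ * (1 - 2 * N⁻¹) ≤ 4 * N⁻¹ :=
        mul_le_of_le_one_right (by positivity) (by linarith)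
      linarith
    rw [hpow p1]
    calc θ * (-Real.log (s (i + 1)) - -Real.log (s i)) * s i ^ 4
        ≤ θ * (4 * N⁻¹ / s (i + 1)) * s i ^ 4 := by
          gcongr
          exact diff_le hi
      _ = θ * (4 * N⁻¹) * (s i / s (i + 1)) * s i ^ 3 := by field_simp
      _ ≤ θ * (4 * N⁻¹) * 3 * 1 := by
          gcongr
          · rw [div_le_iff₀ p2]; exact h3
          · exact pow_le_one₀ p1.le (s_le i)
      _ ≤ (12 * θ + 4) * N⁻¹ := by linarith
  · rw [half, hpow (by positivity)]
    have : (2 * N⁻¹) ^ 4 ≤ 2 * N⁻¹ := pow_le_of_le_one (by positivity) (by linarith) (by norm_num)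
    linarith

end sType

/-! ### The energy norm error -/

theorem eLpNorm_two_eq {g : ℝ → ℝ} (hg : MemLp g 2 volI) :
    eLpNorm g 2 volI = ENNReal.ofReal (√(∫ x, g x ^ 2 ∂volI)) := by
  rw [hg.eLpNorm_eq_integral_rpow_norm (by norm_num) (by norm_num), Real.sqrt_eq_rpow]
  simp

theorem errorNorm_le {ε X : ℝ} {u v w : ℝ → ℝ} (hε : 0 ≤ ε) (hX : 0 ≤ X) (hv : IsAC v)
    (huv : u =ᵐ[volI] v) (hw : IsAC w)
    (h : ε ^ 2 * ∫ x, (deriv v x - deriv w x) ^ 2 ∂volI + ∫ x, (v x - w x) ^ 2 ∂volI ≤ X ^ 2) :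
    errorNorm ε u w ≤ ENNReal.ofReal (2 * X) := by
  have e1 : (fun x => weakDeriv u x - weakDeriv w x) =ᵐ[volI] fun x => deriv v x - deriv w x := by
    filter_upwards [weakDeriv_ae_eq hv huv, weakDeriv_ae_eq hw Filter.EventuallyEq.rfl]
      with x h1 h2
    rw [h1, h2]
  have e2 : (fun x => u x - w x) =ᵐ[volI] fun x => v x - w x := by
    filter_upwards [huv] with x h1
    rw [h1]
  rw [errorNorm, eLpNorm_congr_ae e1, eLpNorm_congr_ae e2,
    eLpNorm_two_eq (g := fun x => deriv v x - deriv w x) (hv.2.sub hw.2),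
    eLpNorm_two_eq (g := fun x => v x - w x) (hv.memLp.sub hw.memLp),
    ← ENNReal.ofReal_mul hε, ← ENNReal.ofReal_add (by positivity) (by positivity)]
  refine ENNReal.ofReal_le_ofReal ?_
  have n1 : 0 ≤ ∫ x, (deriv v x - deriv w x) ^ 2 ∂volI := integral_nonneg fun _ => sq_nonneg _
  have n2 : 0 ≤ ∫ x, (v x - w x) ^ 2 ∂volI := integral_nonneg fun _ => sq_nonneg _
  have b1 : ε * √(∫ x, (deriv v x - deriv w x) ^ 2 ∂volI) ≤ X := by
    refine abs_le_of_sq_le_sq' ?_ hX |>.2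
    rw [mul_pow, Real.sq_sqrt n1]; linarith
  have b2 : √(∫ x, (v x - w x) ^ 2 ∂volI) ≤ X := by
    refine abs_le_of_sq_le_sq' ?_ hX |>.2
    rw [Real.sq_sqrt n2]
    have : 0 ≤ ε ^ 2 * ∫ x, (deriv v x - deriv w x) ^ 2 ∂volI := by positivity
    linarith
  linarith

theorem energy_bound {bLow bUp : ℝ} {b f : ℝ → ℝ} (hbLow : 0 < bLow)
    (hb : AEStronglyMeasurable b volI) (hbb : ∀ᵐ x ∂volI, bLow ≤ b x ∧ b x ≤ bUp)
    (hf : MemLp f 2 volI) : ∃ K > (0 : ℝ), ∀ (ε : ℝ) (u v : ℝ → ℝ), IsWeakSolution ε b f u →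
      IsAC v → u =ᵐ[volI] v → v (-1) = 0 → v 1 = 0 →
      ε ^ 2 * ∫ x, deriv v x ^ 2 ∂volI + ∫ x, v x ^ 2 ∂volI ≤ K := by
  have n0 : 0 ≤ ∫ x, f x ^ 2 ∂volI := integral_nonneg fun _ => sq_nonneg _
  refine ⟨(1 + 1 / bLow) * ((∫ x, f x ^ 2 ∂volI) / bLow) + 1, by positivity,
    fun ε u v hu hv huv v0 v1 => ?_⟩
  have := energy_estimate (U := fun _ => 0) (P := fun _ => 0) (R := fun x => -f x) hbLow hb hbb hf
    hu hv huv v0 v1 (isAC_of_contDiff contDiff_const) rfl rfl (memLp_const 0) hf.neg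
    fun e _ _ _ => by simp
  simp only [deriv_const, sub_zero, even_two, Even.neg_pow, ne_eq, OfNat.ofNat_ne_zero,
    not_false_eq_true, zero_pow, integral_zero, mul_zero, zero_add] at this
  set X := ∫ x, deriv v x ^ 2 ∂volI with hX
  set Y := ∫ x, v x ^ 2 ∂volI with hY
  have X0 : 0 ≤ X := integral_nonneg fun _ => sq_nonneg _
  have Y0 : 0 ≤ Y := integral_nonneg fun _ => sq_nonneg _
  have e : (1 + 1 / bLow) * (ε ^ 2 * X + bLow * Y) =
      ε ^ 2 * X + Y + (1 / bLow * (ε ^ 2 * X) + bLow * Y) := by field_simp; ring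
  have k1 : 0 ≤ 1 / bLow * (ε ^ 2 * X) + bLow * Y := by positivity
  have k2 : (1 + 1 / bLow) * (ε ^ 2 * X + bLow * Y) ≤
      (1 + 1 / bLow) * ((∫ x, f x ^ 2 ∂volI) / bLow) := by gcongr
  linarith

theorem sqrt_mul_meshTheta {bLow : ℝ} (hbLow : 0 < bLow) : √bLow * meshTheta bLow = 4 := by
  have : 0 < √bLow := Real.sqrt_pos.2 hbLow
  rw [meshTheta]; field_simp; norm_num

theorem meshTheta_pos {bLow : ℝ} (hbLow : 0 < bLow) : 0 < meshTheta bLow := by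
  have : 0 < √bLow := Real.sqrt_pos.2 hbLow
  rw [meshTheta]; positivity

/-- From `ε ≤ 1 / N` and `log N ≤ 2 √N`, wide layers force `1 / 4 ≤ 2 θ / √N`, that is `√N ≤ 8 θ`.
-/
theorem le_of_layer_wide {θ ε : ℝ} {N : ℕ} (hθ : 0 < θ) (hN : 1 ≤ N)
    (hεN : ε ≤ (N : ℝ)⁻¹) (h : 1 / 4 ≤ θ * ε * Real.log N) : (N : ℝ) ≤ 64 * θ ^ 2 := by
  have hN0 : (0 : ℝ) < N := by exact_mod_cast hN
  have s0 : 0 < √(N : ℝ) := Real.sqrt_pos.2 hN0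
  have hlog0 : 0 ≤ Real.log N := Real.log_nonneg (by exact_mod_cast hN)
  have hlog : Real.log N ≤ 2 * √N := by
    have := Real.log_le_sub_one_of_pos s0
    rw [Real.log_sqrt hN0.le] at this
    linarith
  have h1 : θ * ε * Real.log N ≤ θ * (N : ℝ)⁻¹ * (2 * √N) := by
    have : θ * ε ≤ θ * (N : ℝ)⁻¹ := by gcongr
    exact mul_le_mul this hlog hlog0 (by positivity)
  have h2 : θ * (N : ℝ)⁻¹ * (2 * √N) = 2 * θ / √N := by
    have : (N : ℝ) = √N * √N := (Real.mul_self_sqrt hN0.le).symm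
    field_simp
    rw [Real.sq_sqrt hN0.le]
  rw [h2] at h1
  have h3 := h.trans h1
  rw [le_div_iff₀ s0] at h3
  have h4 : √(N : ℝ) ≤ 8 * θ := by linarith
  calc (N : ℝ) = √N ^ 2 := (Real.sq_sqrt hN0.le).symm
    _ ≤ (8 * θ) ^ 2 := by gcongr
    _ = 64 * θ ^ 2 := by ring

/-- Approximation of the solutions on a family of meshes with `4 (N / 4)` cells. -/
theorem exists_reluSum_rate {bLow bUp : ℝ} {b f : ℝ → ℝ} (hbLow : 0 < bLow)
    (hb : MemH 1 b) (hf : MemH 1 f) (hbb : ∀ᵐ x ∂volI, bLow ≤ b x ∧ b x ≤ bUp)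
    {node : ℝ → ℕ → ℕ → ℝ} {ρ : ℕ → ℝ} {C₀ : ℝ} (hC₀ : 1 ≤ C₀) (hρ1 : ∀ N, 1 ≤ ρ N)
    (hρ : Monotone ρ)
    (hmesh : ∀ (ε : ℝ) (n : ℕ), 0 < ε → ε ≤ 1 → 0 < n → ε ≤ ((4 * n : ℕ) : ℝ)⁻¹ →
      meshTheta bLow * ε * Real.log (4 * n : ℕ) < 1 / 4 →
      LayerMesh (√bLow) ε (C₀ * (((4 * n : ℕ) : ℝ)⁻¹ * ρ (4 * n))) (4 * n) (node ε (4 * n))) :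
    ∃ C > (0 : ℝ), ∀ ε : ℝ, 0 < ε → ε ≤ 1 → ∀ N : ℕ, 1 ≤ N → (N : ℝ) ≤ 1 / ε →
      ∀ u : ℝ → ℝ, IsWeakSolution ε b f u → ∃ M ≤ N, ∃ s : ℕ → ℝ, ∀ w : ℝ → ℝ,
        w = reluSum M (node ε (4 * (N / 4))) (slopeChange s) →
        w (-1) = 0 ∧ w 1 = 0 ∧ errorNorm ε u w ≤ ENNReal.ofReal (C * (N : ℝ)⁻¹ * ρ N) ∧
        (4 ∣ N → meshTheta bLow * ε * Real.log N < 1 / 4 →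
          ∀ j < N, ∃ p q : ℝ, ∀ t ∈ Icc (node ε N j) (node ε N (j + 1)), w t = p * t + q) := by
  obtain ⟨B, hB, hbB⟩ := hb.exists_ac
  obtain ⟨F, hF, hfF⟩ := hf.exists_ac
  have bm : AEStronglyMeasurable b volI :=
    (ac_integrable hB.1).aestronglyMeasurable.congr hbB.symm
  obtain ⟨K, hK, H⟩ := exists_reluSum_approx hbLow hbb hB hF hbB hfF
  obtain ⟨K₁, hK₁, H₁⟩ := energy_bound hbLow bm hbb ((memLp_congr_ae hfF).2 hF.memLp)
  have hθ := meshTheta_pos hbLow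
  set θ := meshTheta bLow with hθ_def
  refine ⟨2 * (√K * (2 * C₀)) + 2 * √K₁ * (4 + 64 * θ ^ 2), by positivity,
    fun ε hε hε1 N hN hNε u hu => ?_⟩
  obtain ⟨v, hv, huv, v0, v1⟩ := hu.1.exists_ac
  have hN0 : (0 : ℝ) < N := by exact_mod_cast hN
  have hεN : ε ≤ (N : ℝ)⁻¹ := by
    rw [le_inv_comm₀ hε hN0, ← one_div]; exact hNε
  have hρN := hρ1 N
  by_cases hcase : 4 ≤ N ∧ θ * ε * Real.log N < 1 / 4
  · obtain ⟨hN4, hlam⟩ := hcase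
    have hn : 0 < N / 4 := by omega
    set n := N / 4 with hn_def
    have hle : 4 * n ≤ N := by omega
    have hc1 : ((4 * n : ℕ) : ℝ) ≤ N := by exact_mod_cast hle
    have hc0 : (0 : ℝ) < (4 * n : ℕ) := by exact_mod_cast (by omega : 0 < 4 * n)
    -- Rounding `N` down to a multiple of 4 loses at most a factor 2 in the rate.
    have hc2 : (N : ℝ) ≤ 2 * (4 * n : ℕ) := by exact_mod_cast (by omega : N ≤ 2 * (4 * n))
    have hinv : ((4 * n : ℕ) : ℝ)⁻¹ ≤ 2 * (N : ℝ)⁻¹ := by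
      rw [← div_eq_mul_inv, inv_eq_one_div, div_le_div_iff₀ hc0 hN0]; linarith
    have hεn : ε ≤ ((4 * n : ℕ) : ℝ)⁻¹ := hεN.trans (by gcongr)
    have hm := hmesh ε n hε hε1 hn hεn (lt_of_le_of_lt (by gcongr) hlam)
    set κ := C₀ * (((4 * n : ℕ) : ℝ)⁻¹ * ρ (4 * n)) with hκ
    have hρn := hρ1 (4 * n)
    have hκε : ε ≤ κ := by
      refine hεn.trans ?_
      rw [hκ]
      have : ((4 * n : ℕ) : ℝ)⁻¹ ≤ ((4 * n : ℕ) : ℝ)⁻¹ * ρ (4 * n) :=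
        le_mul_of_one_le_right (by positivity) hρn
      exact this.trans (le_mul_of_one_le_left (by positivity) hC₀)
    have hκN : κ ≤ 2 * C₀ * ((N : ℝ)⁻¹ * ρ N) := by
      calc κ ≤ C₀ * (2 * (N : ℝ)⁻¹ * ρ N) := by
            have := hρ hle
            rw [hκ]; gcongr
        _ = 2 * C₀ * ((N : ℝ)⁻¹ * ρ N) := by ring
    obtain ⟨s, w0, w1, hs⟩ := H ε hε hε1 u v hu hv huv v0 v1 κ hκε (4 * n) _ hm
    refine ⟨4 * n, hle, s, fun w hw => ?_⟩
    rw [← hw] at w0 w1 hs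
    have hκ0 : 0 ≤ κ := hε.le.trans hκε
    refine ⟨w0, w1, ?_, fun h4 _ j hj => ?_⟩
    · refine (errorNorm_le hε.le (X := √K * κ) (by positivity) hv huv
        (hw ▸ isAC_reluSum _ _ _) (by rw [mul_pow, Real.sq_sqrt hK.le]; exact hs)).trans ?_
      refine ENNReal.ofReal_le_ofReal ?_
      have z1 := mul_le_mul_of_nonneg_left hκN (Real.sqrt_nonneg K)
      have z2 : 0 ≤ 2 * √K₁ * (4 + 64 * θ ^ 2) * ((N : ℝ)⁻¹ * ρ N) := by positivity
      linarith
    · have hNn : 4 * n = N := by omega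
      rw [hNn] at hw hm
      refine ⟨s j, w (node ε N j) - s j * node ε N j, fun t ht => ?_⟩
      rw [hw, reluSum_eq_affine hm.lt hj ht]
      ring
  · have hNle : (N : ℝ) ≤ 4 + 64 * θ ^ 2 := by
      rw [not_and_or, not_le, not_lt] at hcase
      rcases hcase with h | h
      · have : (N : ℝ) ≤ 4 := by exact_mod_cast h.le
        have : 0 ≤ 64 * θ ^ 2 := by positivity
        linarith
      · have := le_of_layer_wide hθ hN hεN h
        linarith
    -- With no active neuron the realization is zero, and its error is the energy of `u`, bounded
    -- uniformly in `ε`; this meets the rate because `N` is bounded here.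
    refine ⟨0, Nat.zero_le N, fun _ => 0, fun w hw => ?_⟩
    have hw0 : w = fun _ => 0 := by rw [hw]; funext t; simp [reluSum]
    refine ⟨by simp [hw0], by simp [hw0], ?_, fun h4 hlam => ?_⟩
    · have hE := H₁ ε u v hu hv huv v0 v1
      refine (errorNorm_le hε.le (X := √K₁) (by positivity) hv huv
        (hw ▸ isAC_reluSum _ _ _) (by
          rw [Real.sq_sqrt hK₁.le, hw0]; simpa using hE)).trans ?_
      refine ENNReal.ofReal_le_ofReal ?_
      have z1 : 1 ≤ (4 + 64 * θ ^ 2) * ((N : ℝ)⁻¹ * ρ N) := by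
        have : 1 ≤ (4 + 64 * θ ^ 2) * (N : ℝ)⁻¹ := by
          rw [← div_eq_mul_inv, one_le_div hN0]; exact hNle
        nlinarith
      have z2 := mul_le_mul_of_nonneg_left z1 (by positivity : 0 ≤ 2 * √K₁)
      have z3 : 0 ≤ 2 * (√K * (2 * C₀)) * ((N : ℝ)⁻¹ * ρ N) := by positivity
      linarith
    · exact absurd ⟨by omega, hlam⟩ hcase

/-! ### Shallow networks -/

/-- The network with one hidden layer which realizes `reluSum M x c` for `M ≤ N`. -/
def shallowNet (N M : ℕ) (x c : ℕ → ℝ) : NN 1 1 :=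
  .hidden N.succ_pos (fun _ _ => 1) (fun i => -x i)
    (.output (fun _ i => if (i : ℕ) < M then c i else 0) 0)

theorem real1_shallowNet {N M : ℕ} (hM : M ≤ N) (x c : ℕ → ℝ) :
    real1 (shallowNet N M x c) = reluSum M x c := by
  funext t
  have h : real1 (shallowNet N M x c) t =
      ∑ i : Fin (N + 1), (if (i : ℕ) < M then c i else 0) * relu (t - x i) := by
    simp [real1, shallowNet, NN.realize, Matrix.mulVec, dotProduct, sub_eq_add_neg]
  rw [h, Fin.sum_univ_eq_sum_range
    (fun i => (if i < M then c i else 0) * relu (t - x i)) (N + 1), reluSum]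
  refine (Finset.sum_subset_zero_on_sdiff (Finset.range_subset_range.2 (by omega)) ?_ ?_).symm
  · intro i hi
    rw [Finset.mem_sdiff, Finset.mem_range, Finset.mem_range] at hi
    rw [if_neg hi.2, zero_mul]
  · intro i hi
    rw [if_pos (Finset.mem_range.1 hi)]

theorem shallowNet_mem_ofClass (N M : ℕ) (x c : ℕ → ℝ) :
    shallowNet N M x c ∈ NN.ofClass 2 (N + 1) 1 1 :=
  ⟨rfl, max_eq_left (Nat.le_add_left 1 N)⟩

theorem NN.layerSize_le {d m : ℕ} (A : Matrix (Fin m) (Fin d) ℝ) (b : Fin m → ℝ) :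
    NN.layerSize A b ≤ m * d + m := by
  refine add_le_add ((Set.ncard_le_card _).trans ?_) ((Set.ncard_le_card _).trans ?_) <;> simp

theorem size_shallowNet_le {N : ℕ} (hN : 1 ≤ N) (M : ℕ) (x c : ℕ → ℝ) :
    (shallowNet N M x c).size ≤ 7 * N := by
  refine (add_le_add (NN.layerSize_le _ _) (NN.layerSize_le _ _)).trans ?_
  -- The two layers have at most `2 (N + 1) + (N + 2) = 3 N + 4` entries, and `N ≥ 1`.
  omega

end SingPert

end

/-! ### Assembly of the two families of networks -/

theorem theorem4p1 (bLow : ℝ) (hbLow : 0 < bLow) :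
    ∃ (AS : ℝ → (N : ℕ) → Matrix (Fin (N + 1)) (Fin 1) ℝ) (βS : ℝ → (N : ℕ) → Fin (N + 1) → ℝ),
      ∀ (k : ℕ) (_ : k = 1 ∨ k = 2) (bUp : ℝ) (b f : ℝ → ℝ)
        (_ : SingPert.MemH k b) (_ : SingPert.MemH k f)
        (_ : ∀ᵐ x ∂SingPert.volI, bLow ≤ b x ∧ b x ≤ bUp),
        ∃ C > (0 : ℝ), ∃ C' > (0 : ℝ),
          ∀ ε : ℝ, 0 < ε → ε ≤ 1 → ∀ N : ℕ, 1 ≤ N → (N : ℝ) ≤ 1 / ε →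
          ∀ u : ℝ → ℝ, SingPert.IsWeakSolution ε b f u →
          ∃ ΦS ∈ SingPert.NN.ofClass 2 (N + 1) 1 1, ∃ ΦE ∈ SingPert.NN.ofClass 2 (N + 1) 1 1,
            -- the error bounds (the realizations are in `H¹(I)`)
            SingPert.MemH 1 (SingPert.real1 ΦS) ∧
            SingPert.MemH 1 (SingPert.real1 ΦE) ∧
            SingPert.errorNorm ε u (SingPert.real1 ΦS)
              ≤ ENNReal.ofReal (C * (N : ℝ)⁻¹ * (1 + Real.log N)) ∧
            SingPert.errorNorm ε u (SingPert.real1 ΦE) ≤ ENNReal.ofReal (C * (N : ℝ)⁻¹) ∧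
            -- homogeneous boundary values
            SingPert.real1 ΦS (-1) = 0 ∧ SingPert.real1 ΦS 1 = 0 ∧
            SingPert.real1 ΦE (-1) = 0 ∧ SingPert.real1 ΦE 1 = 0 ∧
            -- size
            (ΦS.size : ℝ) + (ΦE.size : ℝ) ≤ C' * N ∧
            -- the hidden layer of `ΦS` depends on `ε` and `N` only, not on `b`, `f`, `u`
            (∃ Ψ : SingPert.NN (N + 1) 1,
              ΦS = SingPert.NN.hidden N.succ_pos (AS ε N) (βS ε N) Ψ) ∧
            -- the realizations are finite element functions on the Shishkin and the eXp mesh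
            (4 ∣ N → SingPert.meshTheta bLow * ε * Real.log N < 1 / 4 →
              SingPert.MemS10 N (SingPert.shishkinNode (SingPert.meshTheta bLow) ε N)
                (SingPert.real1 ΦS) ∧
              SingPert.MemS10 N (SingPert.expNode (SingPert.meshTheta bLow) ε N)
                (SingPert.real1 ΦE)) := by

  have hθ := SingPert.meshTheta_pos hbLow
  have hβ := Real.sqrt_pos.2 hbLow
  have hβθ := SingPert.sqrt_mul_meshTheta hbLow
  -- The hidden layer computes `relu (t - x i)` at the Shishkin nodes for `4 * (N / 4)` cells, which
  -- involve only `ε`, `N` and `bLow`; surplus neurons are switched off by the output layer.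
  refine ⟨fun _ _ _ _ => 1,
    fun ε N i => -SingPert.shishkinNode (SingPert.meshTheta bLow) ε (4 * (N / 4)) i,
    fun k hk bUp b f hb hf hbb => ?_⟩
  have hb1 : SingPert.MemH 1 b := by
    rcases hk with rfl | rfl
    exacts [hb, hb.one_of_two]
  have hf1 : SingPert.MemH 1 f := by
    rcases hk with rfl | rfl
    exacts [hf, hf.one_of_two]
  obtain ⟨C₁, hC₁, H₁⟩ := SingPert.exists_reluSum_rate hbLow hb1 hf1 hbb
    (node := SingPert.shishkinNode (SingPert.meshTheta bLow)) (ρ := fun N => 1 + Real.log N)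
    (C₀ := 4 * SingPert.meshTheta bLow + 4) (by linarith)
    (fun N => le_add_of_nonneg_right (Real.log_natCast_nonneg N))
    (fun M N hMN => by
      rcases Nat.eq_zero_or_pos M with rfl | hM
      · simpa using Real.log_natCast_nonneg N
      · have : (0 : ℝ) < M := by exact_mod_cast hM
        dsimp only
        gcongr)
    fun ε n hε hε1 hn _ hlam => SingPert.shishkinNode_layerMesh hn hε hε1 hθ hβ hβθ hlam
  obtain ⟨C₂, hC₂, H₂⟩ := SingPert.exists_reluSum_rate hbLow hb1 hf1 hbb
    (node := SingPert.expNode (SingPert.meshTheta bLow)) (ρ := fun _ => 1)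
    (C₀ := 12 * SingPert.meshTheta bLow + 4) (by linarith) (fun _ => le_rfl)
    monotone_const
    fun ε n hε _ hn hεn hlam => by
      simpa only [mul_one] using SingPert.expNode_layerMesh hn hε hεn hθ hβ hβθ hlam
  refine ⟨C₁ + C₂, by positivity, 14, by norm_num, fun ε hε hε1 N hN hNε u hu => ?_⟩
  obtain ⟨M₁, hM₁, s₁, h₁⟩ := H₁ ε hε hε1 N hN hNε u hu
  obtain ⟨M₂, hM₂, s₂, h₂⟩ := H₂ ε hε hε1 N hN hNε u hu
  -- All properties were stated for any `w` equal to the ReLU sum, so they pass directly to the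
  -- realization of the network.
  obtain ⟨zl₁, zr₁, e₁, a₁⟩ := h₁ _ (SingPert.real1_shallowNet hM₁ _ _)
  obtain ⟨zl₂, zr₂, e₂, a₂⟩ := h₂ _ (SingPert.real1_shallowNet hM₂ _ _)
  have ac₁ := SingPert.isAC_reluSum M₁
    (SingPert.shishkinNode (SingPert.meshTheta bLow) ε (4 * (N / 4))) (SingPert.slopeChange s₁)
  have ac₂ := SingPert.isAC_reluSum M₂
    (SingPert.expNode (SingPert.meshTheta bLow) ε (4 * (N / 4))) (SingPert.slopeChange s₂)
  rw [← SingPert.real1_shallowNet hM₁] at ac₁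
  rw [← SingPert.real1_shallowNet hM₂] at ac₂
  refine ⟨_, SingPert.shallowNet_mem_ofClass N M₁ _ _, _, SingPert.shallowNet_mem_ofClass N M₂ _ _,
    ac₁.memH, ac₂.memH, e₁.trans ?_, e₂.trans ?_, zl₁, zr₁, zl₂, zr₂, ?_, ⟨_, rfl⟩,
    fun h4 hlam => ⟨⟨ac₁.memH10 zl₁ zr₁, a₁ h4 hlam⟩, ⟨ac₂.memH10 zl₂ zr₂, a₂ h4 hlam⟩⟩⟩
  · have := Real.log_natCast_nonneg N
    refine ENNReal.ofReal_le_ofReal ?_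
    gcongr
    linarith
  · rw [mul_one]
    refine ENNReal.ofReal_le_ofReal ?_
    gcongr
    linarith
  · have x1 := SingPert.size_shallowNet_le hN M₁
      (SingPert.shishkinNode (SingPert.meshTheta bLow) ε (4 * (N / 4))) (SingPert.slopeChange s₁)
    have x2 := SingPert.size_shallowNet_le hN M₂
      (SingPert.expNode (SingPert.meshTheta bLow) ε (4 * (N / 4))) (SingPert.slopeChange s₂)
    exact_mod_cast (by omega : _ ≤ 14 * N)
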